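/- Fix a number of players $n$. In a concave game $\Gamma$ each player $i\in[n]$ has a convex compact strategy set $\mathcal X_i\subset\mathbb R^{d_i}$ and a utility $u_i:\mathcal X=\mathcal X_1\times\dots\times\mathcal X_n\to[0,1]$ that is concave in her own strategy $x_i$ when the other strategies are fixed. Given feature maps $m_i:\mathcal X_i\to\mathbb R^{k_i}$, let $\Phi_{m_i}$ be the set of all maps $\phi:\mathcal X_i\to\mathcal X_i$ of the form $\phi(x)=K\,m_i(x)$ with $K\in\mathbb R^{d_i\times k_i}$. For $\varepsilon>0$, an $\varepsilon$-approximate $\Phi_m$-equilibrium is a finitely supported probability distribution $\mu$ on $\mathcal X$ with $$\mathbb E_{x\sim\mu}\bigl[u_i(\phi_i(x_i),x_{-i})-u_i(x)\bigr]\le\varepsilon\qquad\text{for all } i\in[n]\text{ and all }\phi_i\in\Phi_{m_i}.$$ Computation model: a real RAM, in which arithmetic operations and comparisons of real numbers take unit time, with oracles for each player $i$: a separation oracle for $\mathcal X_i$ (which on input $x$ either reports $x\in\mathcal X_i$ or returns a hyperplane separating $x$ from $\mathcal X_i$), an evaluation oracle for $u_i$, an oracle returning at each $x\in\mathcal X$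 a supergradient of $u_i(\cdot,x_{-i})$ at $x_i$ of Euclidean norm at most $1$, and an evaluation oracle for $m_i$. Also given are the numbers $d_i,k_i$, the precision $\varepsilon>0$, a radius $R>0$ with $B(0,1)\subseteq\mathcal X_i\subseteq B(0,R)$ for all $i$, and a bound $D\ge 0$ such that for all $i$ the coordinates of $m_i$ are at most $D$ in absolute value on $\mathcal X_i$ and every $\phi\in\Phi_{m_i}$ can be written as $\phi(x)=K\,m_i(x)$ with $\|K\|_F\le D$. A distribution is output as a list of points of $\mathcal X$ with their probabilities. Theorem. For every fixed $n$ there are an algorithm in this model and a polynomial $p$ such that, for every $n$-player concave game and all feature maps as above, with $d=\sum_i d_i$ and $k=\sum_i k_i$, the algorithm outputs an $\varepsilon$-approximate $\Phi_m$-equilibrium in time at most $p(d,k,R,D,1/\varepsilon)$. In particular, when $D\le\mathrm{poly}(d,k,R)$, the running time is $\mathrm{poly}(d,k,R,1/\varepsilon)$. -/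

import Mathlib

open scoped BigOperators

namespace PhiEq

/-! ### Concave games, deviations and equilibria -/

/-- Euclidean space `ℝ^d` with the `ℓ₂` norm. -/
abbrev Vec (d : ℕ) : Type := EuclideanSpace ℝ (Fin d)

/-- Points of `ℝ^{d_1} × ⋯ × ℝ^{d_n}`. -/
abbrev Profile {n : ℕ} (d : Fin n → ℕ) : Type := (i : Fin n) → Vec (d i)

/-- An `n`-player concave game. Utilities are total functions of which only the values on the
product `X_1 × ⋯ × X_n` of the strategy sets matter. -/
structure ConcaveGame (n : ℕ) where
  /-- dimensions of the strategy sets -/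
  d : Fin n → ℕ
  /-- strategy sets -/
  X : (i : Fin n) → Set (Vec (d i))
  /-- utilities -/
  u : Fin n → Profile d → ℝ
  convex_X : ∀ i, Convex ℝ (X i)
  compact_X : ∀ i, IsCompact (X i)
  u_mem : ∀ i, ∀ x : Profile d, (∀ j, x j ∈ X j) → u i x ∈ Set.Icc (0 : ℝ) 1
  concave_u : ∀ i, ∀ x : Profile d, (∀ j, x j ∈ X j) →
    ConcaveOn ℝ (X i) (fun y => u i (Function.update x i y))

namespace ConcaveGame

/-- The set `X_1 × ⋯ × X_n` of strategy profiles. -/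
def profiles {n : ℕ} (Γ : ConcaveGame n) : Set (Profile Γ.d) :=
  {x | ∀ i, x i ∈ Γ.X i}

end ConcaveGame

/-- A finitely supported probability distribution, given by a list of points with their
probabilities. -/
structure FinDist (α : Type*) where
  size : ℕ
  weight : Fin size → ℝ
  point : Fin size → α
  weight_nonneg : ∀ j, 0 ≤ weight j
  weight_sum : ∑ j, weight j = 1

/-- The expectation `E_{x ∼ μ} f(x)`. -/
noncomputable def FinDist.expect {α : Type*} (μ : FinDist α) (f : α → ℝ) : ℝ :=
  ∑ j, μ.weight j * f (μ.point j)

/-- `μ ∈ Δ(S)`. -/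
def FinDist.SupportedOn {α : Type*} (μ : FinDist α) (S : Set α) : Prop :=
  ∀ j, μ.point j ∈ S

/-- The matrix `K` represents `φ` on `X` through the feature map `m`: `φ(x) = K m(x)`. -/
def Represents {d k : ℕ} (X : Set (Vec d)) (m : Vec d → Fin k → ℝ)
    (K : Matrix (Fin d) (Fin k) ℝ) (φ : Vec d → Vec d) : Prop :=
  ∀ x ∈ X, ∀ c, φ x c = K.mulVec (m x) c

/-- `Φ_m`: all maps `X → X` of the form `x ↦ K m(x)` (as total functions, of which only the
restriction to `X` matters). -/
def phiSet {d k : ℕ} (X : Set (Vec d)) (m : Vec d → Fin k → ℝ) : Set (Vec d → Vec d) :=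
  {φ | Set.MapsTo φ X X ∧ ∃ K : Matrix (Fin d) (Fin k) ℝ, Represents X m K φ}

/-- `μ` is an `ε`-approximate `Φ`-equilibrium of `Γ`. -/
def IsApproxEquilibrium {n : ℕ} (Γ : ConcaveGame n)
    (Φ : (i : Fin n) → Set (Vec (Γ.d i) → Vec (Γ.d i))) (ε : ℝ)
    (μ : FinDist (Profile Γ.d)) : Prop :=
  μ.SupportedOn Γ.profiles ∧
    ∀ i, ∀ φ ∈ Φ i,
      μ.expect (fun x => Γ.u i (Function.update x i (φ (x i))) - Γ.u i x) ≤ ε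

/-- The quantitative bound `D` on the feature map `m` on `X`: its entries are at most `D` in
absolute value, and every map in `Φ_m` has a representing matrix of Frobenius norm at most `D`. -/
def FeatureBound {d k : ℕ} (X : Set (Vec d)) (m : Vec d → Fin k → ℝ) (D : ℝ) : Prop :=
  (∀ x ∈ X, ∀ j, |m x j| ≤ D) ∧
    ∀ φ ∈ phiSet X m, ∃ K : Matrix (Fin d) (Fin k) ℝ,
      Represents X m K φ ∧ ∑ c, ∑ j, K c j ^ 2 ≤ D ^ 2

/-! ### Black-box access -/

/-- The oracles available to an algorithm. -/
structure Oracles {n : ℕ} (d k : Fin n → ℕ) where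
  /-- separation oracle: `none` means "inside", `some (a, b)` is the hyperplane `⟪a, z⟫ = b` -/
  sep : (i : Fin n) → Vec (d i) → Option (Vec (d i) × ℝ)
  /-- utility evaluation -/
  util : Fin n → Profile d → ℝ
  /-- supergradient of player `i`'s utility with respect to her own strategy -/
  grad : (i : Fin n) → Profile d → Vec (d i)
  /-- feature map evaluation -/
  feat : (i : Fin n) → Vec (d i) → Fin (k i) → ℝ

/-- The promises on the oracles. Answers to utility, supergradient and feature queries at points
outside the strategy sets are arbitrary. -/
structure Oracles.Correct {n : ℕ} (Γ : ConcaveGame n) {k : Fin n → ℕ}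
    (m : (i : Fin n) → Vec (Γ.d i) → Fin (k i) → ℝ) (O : Oracles Γ.d k) : Prop where
  sep_mem : ∀ i, ∀ x ∈ Γ.X i, O.sep i x = none
  sep_not_mem : ∀ i, ∀ x ∉ Γ.X i, ∃ a b, O.sep i x = some (a, b) ∧
    b < inner ℝ a x ∧ ∀ z ∈ Γ.X i, inner ℝ a z ≤ b
  util_eq : ∀ i, ∀ x ∈ Γ.profiles, O.util i x = Γ.u i x
  grad_norm : ∀ i, ∀ x ∈ Γ.profiles, ‖O.grad i x‖ ≤ 1
  grad_super : ∀ i, ∀ x ∈ Γ.profiles, ∀ y ∈ Γ.X i,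
    Γ.u i (Function.update x i y) ≤ Γ.u i x + inner ℝ (O.grad i x) (y - x i)
  feat_eq : ∀ i, ∀ x ∈ Γ.X i, O.feat i x = m i x

/-! ### The real RAM -/

/-- Memory: an array of natural numbers (for control and addressing) and an array of reals. -/
structure Mem where
  nat : ℕ → ℕ
  real : ℕ → ℝ

/-- Natural-number expressions; `mem a` is the content of the natural-number cell at address `a`. -/
inductive NExp : Type
  | const : ℕ → NExp
  | mem : NExp → NExp
  | add : NExp → NExp → NExp
  | sub : NExp → NExp → NExp
  | mul : NExp → NExp → NExp

namespace NExp

def eval (s : Mem) : NExp → ℕ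
  | const c => c
  | mem a => s.nat (a.eval s)
  | add a b => a.eval s + b.eval s
  | sub a b => a.eval s - b.eval s
  | mul a b => a.eval s * b.eval s

/-- Number of unit-time operations. -/
def cost : NExp → ℕ
  | const _ => 1
  | mem a => a.cost + 1
  | add a b => a.cost + b.cost + 1
  | sub a b => a.cost + b.cost + 1
  | mul a b => a.cost + b.cost + 1

end NExp

/-- Real expressions; `mem a` is the content of the real cell at address `a`. The only real
constants are natural numbers. -/
inductive RExp : Type
  | ofNat : NExp → RExp
  | mem : NExp → RExp
  | add : RExp → RExp → RExp
  | sub : RExp → RExp → RExp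
  | mul : RExp → RExp → RExp
  | div : RExp → RExp → RExp

namespace RExp

noncomputable def eval (s : Mem) : RExp → ℝ
  | ofNat a => (a.eval s : ℝ)
  | mem a => s.real (a.eval s)
  | add a b => a.eval s + b.eval s
  | sub a b => a.eval s - b.eval s
  | mul a b => a.eval s * b.eval s
  | div a b => a.eval s / b.eval s

/-- Number of unit-time operations. -/
def cost : RExp → ℕ
  | ofNat a => a.cost + 1
  | mem a => a.cost + 1
  | add a b => a.cost + b.cost + 1
  | sub a b => a.cost + b.cost + 1
  | mul a b => a.cost + b.cost + 1
  | div a b => a.cost + b.cost + 1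

end RExp

/-- Tests. -/
inductive BExp : Type
  | nlt : NExp → NExp → BExp
  | rlt : RExp → RExp → BExp
  | not : BExp → BExp
  | and : BExp → BExp → BExp

namespace BExp

def holds (s : Mem) : BExp → Prop
  | nlt a b => a.eval s < b.eval s
  | rlt a b => a.eval s < b.eval s
  | not a => ¬ a.holds s
  | and a b => a.holds s ∧ b.holds s

/-- Number of unit-time operations. -/
def cost : BExp → ℕ
  | nlt a b => a.cost + b.cost + 1
  | rlt a b => a.cost + b.cost + 1
  | not a => a.cost + 1
  | and a b => a.cost + b.cost + 1

end BExp

/-- Programs for `n`-player games. In the oracle calls, `src` is the address where the query point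
is stored and `dst` the address where the answer is to be written; `sep` also reports in the
natural-number cell `flag` whether the query point is inside. -/
inductive Prog (n : ℕ) : Type
  | skip : Prog n
  | nset (dst : NExp) (e : NExp) : Prog n
  | rset (dst : NExp) (e : RExp) : Prog n
  | seq : Prog n → Prog n → Prog n
  | ite : BExp → Prog n → Prog n → Prog n
  | loop : BExp → Prog n → Prog n
  | sep (i : Fin n) (src dst flag : NExp) : Prog n
  | util (i : Fin n) (src dst : NExp) : Prog n
  | grad (i : Fin n) (src dst : NExp) : Prog n
  | feat (i : Fin n) (src dst : NExp) : Prog n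

namespace Mem

/-- The vector stored in the cells `a, …, a + d - 1`. -/
noncomputable def readVec (s : Mem) (d a : ℕ) : Vec d :=
  WithLp.toLp 2 (fun c : Fin d => s.real (a + c))

/-- Start of block `i` in the concatenation of blocks of lengths `d_1, …, d_n`. -/
def offset {n : ℕ} (d : Fin n → ℕ) (i : Fin n) : ℕ := ∑ j ∈ Finset.Iio i, d j

/-- The profile stored, blocks concatenated, in the cells `a, …, a + ∑ i, d i - 1`. -/
noncomputable def readProfile {n : ℕ} (s : Mem) (d : Fin n → ℕ) (a : ℕ) : Profile d :=
  fun i => s.readVec (d i) (a + offset d i)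

def setNat (s : Mem) (a v : ℕ) : Mem := { s with nat := Function.update s.nat a v }

def setReal (s : Mem) (a : ℕ) (v : ℝ) : Mem := { s with real := Function.update s.real a v }

/-- Write `v` into the cells `a, …, a + d - 1`. -/
def writeVec (s : Mem) {d : ℕ} (a : ℕ) (v : Fin d → ℝ) : Mem :=
  { s with real := fun b => if h : a ≤ b ∧ b < a + d then v ⟨b - a, by omega⟩ else s.real b }

/-- Record the answer of a separation oracle: inside, the flag is set to `1`; outside, it is set
to `0` and the normal vector, followed by the offset, is written at `dst`. -/
def writeSep (s : Mem) {d : ℕ} (dst flag : ℕ) : Option (Vec d × ℝ) → Mem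
  | none => s.setNat flag 1
  | some (a, b) => ((s.setNat flag 0).writeVec dst (fun c => a c)).setReal (dst + d) b

end Mem

/-- `Exec O P s t s'`: run with the oracles `O` from memory `s`, the program `P` halts in memory
`s'` after exactly `t` time units. An arithmetic operation, comparison or memory access takes one
unit; an oracle call takes one unit plus one per real number transferred. -/
inductive Exec {n : ℕ} {d k : Fin n → ℕ} (O : Oracles d k) : Prog n → Mem → ℕ → Mem → Prop
  | skip (s : Mem) : Exec O .skip s 1 s
  | nset (s : Mem) (a e : NExp) :
      Exec O (.nset a e) s (a.cost + e.cost + 1) (s.setNat (a.eval s) (e.eval s))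
  | rset (s : Mem) (a : NExp) (e : RExp) :
      Exec O (.rset a e) s (a.cost + e.cost + 1) (s.setReal (a.eval s) (e.eval s))
  | seq {P Q : Prog n} {s s' s'' : Mem} {t t' : ℕ} :
      Exec O P s t s' → Exec O Q s' t' s'' → Exec O (.seq P Q) s (t + t') s''
  | ite_true {b : BExp} {P Q : Prog n} {s s' : Mem} {t : ℕ} :
      b.holds s → Exec O P s t s' → Exec O (.ite b P Q) s (b.cost + t + 1) s'
  | ite_false {b : BExp} {P Q : Prog n} {s s' : Mem} {t : ℕ} :
      ¬ b.holds s → Exec O Q s t s' → Exec O (.ite b P Q) s (b.cost + t + 1) s'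
  | loop_done {b : BExp} {P : Prog n} {s : Mem} :
      ¬ b.holds s → Exec O (.loop b P) s (b.cost + 1) s
  | loop_step {b : BExp} {P : Prog n} {s s' s'' : Mem} {t t' : ℕ} :
      b.holds s → Exec O P s t s' → Exec O (.loop b P) s' t' s'' →
        Exec O (.loop b P) s (b.cost + t + t' + 1) s''
  | sep (s : Mem) (i : Fin n) (src dst flag : NExp) :
      Exec O (.sep i src dst flag) s
        (src.cost + dst.cost + flag.cost + (2 * d i + 1) + 1)
        (s.writeSep (dst.eval s) (flag.eval s) (O.sep i (s.readVec (d i) (src.eval s))))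
  | util (s : Mem) (i : Fin n) (src dst : NExp) :
      Exec O (.util i src dst) s (src.cost + dst.cost + (∑ j, d j + 1) + 1)
        (s.setReal (dst.eval s) (O.util i (s.readProfile d (src.eval s))))
  | grad (s : Mem) (i : Fin n) (src dst : NExp) :
      Exec O (.grad i src dst) s (src.cost + dst.cost + (∑ j, d j + d i) + 1)
        (s.writeVec (dst.eval s) (fun c => O.grad i (s.readProfile d (src.eval s)) c))
  | feat (s : Mem) (i : Fin n) (src dst : NExp) :
      Exec O (.feat i src dst) s (src.cost + dst.cost + (d i + k i) + 1)
        (s.writeVec (dst.eval s) (O.feat i (s.readVec (d i) (src.eval s))))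

/-- Initial memory: natural-number cells `0, …, 2n - 1` hold `d_1, …, d_n, k_1, …, k_n`, real
cells `0, 1, 2` hold `ε, R, D`, everything else is `0`. -/
def initMem {n : ℕ} (d k : Fin n → ℕ) (ε R D : ℝ) : Mem where
  nat a := if h : a < n then d ⟨a, h⟩ else if h : a - n < n then k ⟨a - n, h⟩ else 0
  real a := if a = 0 then ε else if a = 1 then R else if a = 2 then D else 0

/-- The memory holds the distribution `μ`: natural-number cell `0` holds the number of listed
points, and the `j`-th block of `1 + ∑ i, d i` real cells holds the probability and the
coordinates of the `j`-th point. -/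
def Outputs {n : ℕ} {d : Fin n → ℕ} (s : Mem) (μ : FinDist (Profile d)) : Prop :=
  s.nat 0 = μ.size ∧
    ∀ j : Fin μ.size,
      s.real (j * (1 + ∑ i, d i)) = μ.weight j ∧
        s.readProfile d (j * (1 + ∑ i, d i) + 1) = μ.point j

end PhiEq

/-!
Let `Q` be an integer that exceeds `3 / ε`, `R`, `D` and all dimensions. Every player `i` keeps a
matrix `K` and follows the trajectory `y₀ = 0`, `yₗ₊₁ = K m(yₗ)` for `Q` steps. If it leaves her
strategy set `X`, the oracle returns a hyperplane `⟪a, z⟫ ≤ b` that separates `yₗ₊₁ = K m(yₗ)` from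
`X`, and she adds `-(b / (‖a‖² Q⁴)) a m(yₗ)ᵀ` to `K` and starts again. Let `K'` be the matrix of a
map of `X` into itself. Since `K' m(yₗ) ∈ X` and `X` contains the unit ball, `(1 - 1 / Q) K' m(yₗ)`
satisfies the inequality with the margin `b / Q`, so that, because of `‖m(yₗ)‖² ≤ Q³`, the cut moves
`K` closer to `(1 - 1 / Q) K'`, by at least `1 / Q⁵` in the square of the distance. Hence there are
only polynomially many cuts.

When all trajectories have stayed inside, all `Q ^ n` profiles picked from their first `Q` points
are played, a polynomial number as `n` is fixed. Along a trajectory the map `y ↦ K m(y)` is a shift,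
so the gains it promises telescope and contribute at most `1 / Q` on average. By concavity the
further gain of `K'` over `K` is at most linear in `K' - K`, and a gradient step on `K` of length
`1 / Q ^ (n + 4)` per profile pays for it as in online gradient descent, where
`‖K - (1 - 1 / Q) K'‖²` is the potential. Summed over `Q ^ 7` rounds, the average gain is at most
`3 / Q < ε`.
-/

namespace PhiEq

open Polynomial (X)
open scoped Polynomial

/-! ### Total correctness with polynomial running times -/

namespace Mem

@[simp] theorem setNat_nat (s : Mem) (a v b : ℕ) :
    (s.setNat a v).nat b = if b = a then v else s.nat b := by
  simp [setNat, Function.update_apply]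

@[simp] theorem setNat_real (s : Mem) (a v : ℕ) : (s.setNat a v).real = s.real := rfl

@[simp] theorem setReal_nat (s : Mem) (a : ℕ) (v : ℝ) : (s.setReal a v).nat = s.nat := rfl

@[simp] theorem setReal_real (s : Mem) (a : ℕ) (v : ℝ) (b : ℕ) :
    (s.setReal a v).real b = if b = a then v else s.real b := by
  simp [setReal, Function.update_apply]

@[simp] theorem writeVec_nat (s : Mem) {d : ℕ} (a : ℕ) (v : Fin d → ℝ) :
    (s.writeVec a v).nat = s.nat := rfl

theorem writeVec_real_add (s : Mem) {d : ℕ} (a : ℕ) (v : Fin d → ℝ) (c : Fin d) :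
    (s.writeVec a v).real (a + c) = v c := by
  simp [writeVec]

theorem writeVec_real_of_notMem (s : Mem) {d : ℕ} (a : ℕ) (v : Fin d → ℝ) {b : ℕ}
    (hb : ¬ (a ≤ b ∧ b < a + d)) : (s.writeVec a v).real b = s.real b := by
  simp only [writeVec, dif_neg hb]

end Mem

/-- `s` and `s'` agree on the natural-number cells below `h`: the cells from `h` on are free for
use by the part of the program that leads from `s` to `s'`. -/
def AgreeBelow (h : ℕ) (s s' : Mem) : Prop := ∀ a < h, s'.nat a = s.nat a

namespace AgreeBelow

variable {h h' a v : ℕ} {s s' s'' : Mem}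

theorem refl (h : ℕ) (s : Mem) : AgreeBelow h s s := fun _ _ => rfl

theorem trans (h₁ : AgreeBelow h s s') (h₂ : AgreeBelow h s' s'') : AgreeBelow h s s'' :=
  fun a ha => (h₂ a ha).trans (h₁ a ha)

theorem mono (h₁ : AgreeBelow h s s') (hh : h' ≤ h) : AgreeBelow h' s s' :=
  fun a ha => h₁ a (ha.trans_le hh)

theorem setNat (h₁ : AgreeBelow h s s') (ha : h ≤ a) : AgreeBelow h s (s'.setNat a v) :=
  fun b hb => by rw [Mem.setNat_nat, if_neg (by omega), h₁ b hb]

end AgreeBelow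

instance : Add NExp := ⟨NExp.add⟩
instance : Mul NExp := ⟨NExp.mul⟩
instance : Add RExp := ⟨RExp.add⟩
instance : Sub RExp := ⟨RExp.sub⟩
instance : Mul RExp := ⟨RExp.mul⟩
instance : Div RExp := ⟨RExp.div⟩

namespace NExp

/-- The content of the natural-number cell `a`. -/
def var (a : ℕ) : NExp := .mem (.const a)

/-- The sum `e_0 + ⋯ + e_{m-1}` as an expression. -/
def sum {m : ℕ} (e : Fin m → NExp) : NExp := Fin.foldl m (fun a i => a + e i) (const 0)

/-- The power `e ^ r`, for a fixed exponent `r`, as an expression. -/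
def pow (e : NExp) : ℕ → NExp
  | 0 => const 1
  | r + 1 => pow e r * e

variable (s : Mem)

@[simp] theorem eval_const (c : ℕ) : (const c).eval s = c := rfl
@[simp] theorem eval_var (a : ℕ) : (var a).eval s = s.nat a := rfl
@[simp] theorem eval_add (a b : NExp) : (a + b).eval s = a.eval s + b.eval s := rfl
@[simp] theorem eval_mul (a b : NExp) : (a * b).eval s = a.eval s * b.eval s := rfl

@[simp] theorem eval_sum {m : ℕ} (e : Fin m → NExp) : (sum e).eval s = ∑ i, (e i).eval s := by
  induction m with
  | zero => simp [sum]
  | succ m ih =>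
    rw [sum, Fin.foldl_succ_last, Fin.sum_univ_castSucc, ← ih]
    rfl

@[simp] theorem eval_pow (e : NExp) (r : ℕ) : (pow e r).eval s = e.eval s ^ r := by
  induction r with
  | zero => rfl
  | succ r ih => simp [pow, ih, _root_.pow_succ]

end NExp

namespace RExp

variable (s : Mem)

@[simp] theorem eval_ofNat (a : NExp) : (ofNat a).eval s = (a.eval s : ℝ) := rfl
@[simp] theorem eval_mem (a : NExp) : (mem a).eval s = s.real (a.eval s) := rfl
@[simp] theorem eval_add (a b : RExp) : (a + b).eval s = a.eval s + b.eval s := rfl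
@[simp] theorem eval_sub (a b : RExp) : (a - b).eval s = a.eval s - b.eval s := rfl
@[simp] theorem eval_mul (a b : RExp) : (a * b).eval s = a.eval s * b.eval s := rfl
@[simp] theorem eval_div (a b : RExp) : (a / b).eval s = a.eval s / b.eval s := rfl

end RExp

/-- Started in `s`, the program `P` halts within `f(q)` time units in a memory satisfying `post`.
The bound is a polynomial `f` in a size parameter `q`, so that the bounds of composite programs
are read off the rules below by unification. -/
def Runs {n : ℕ} {d k : Fin n → ℕ} (O : Oracles d k) (q : ℕ) (P : Prog n) (s : Mem) (f : ℕ[X])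
    (post : Mem → Prop) : Prop :=
  ∃ t s', Exec O P s t s' ∧ t ≤ f.eval q ∧ post s'

namespace Prog

variable {n : ℕ}

/-- `for v := 0, …, e - 1 do P`. -/
def forN (v : ℕ) (e : NExp) (P : Prog n) : Prog n :=
  .seq (.nset (.const v) (.const 0))
    (.loop (.nlt (.var v) e) (.seq P (.nset (.const v) (.var v + .const 1))))

/-- `for` loops with range `e` nested `m` deep, with the counters `v, …, v + m - 1`, the last one
outermost. -/
def nest (v : ℕ) (e : NExp) (P : Prog n) : ℕ → Prog n
  | 0 => P
  | m + 1 => forN (v + m) e (nest v e P m)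

/-- The programs `P 0, …, P (m - 1)` one after the other. -/
def seqs {m : ℕ} (P : Fin m → Prog n) : Prog n := Fin.foldl m (fun S i => .seq S (P i)) .skip

end Prog

namespace Runs

variable {n : ℕ} {d k : Fin n → ℕ} {O : Oracles d k} {q : ℕ} {P P' : Prog n} {s : Mem}
  {f g : ℕ[X]} {post post' : Mem → Prop}

theorem mono (h : Runs O q P s f post) (hp : ∀ s', post s' → post' s') :
    Runs O q P s f post' := by
  obtain ⟨t, s', hexec, ht, hs'⟩ := h
  exact ⟨t, s', hexec, ht, hp s' hs'⟩

theorem of_exec {c t : ℕ} {s' : Mem} (h : Exec O P s t s') (ht : t ≤ c + 2 * q) (hs' : post s') :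
    Runs O q P s ((c : ℕ[X]) + 2 * X) post :=
  ⟨t, s', h, by simpa using ht, hs'⟩

theorem skip (h : post s) : Runs O q .skip s 1 post :=
  ⟨1, s, .skip s, by simp, h⟩

theorem seq (h : Runs O q P s f post) (h' : ∀ s', post s' → Runs O q P' s' g post') :
    Runs O q (.seq P P') s (f + g) post' := by
  obtain ⟨t, s', hexec, ht, hs'⟩ := h
  obtain ⟨t', s'', hexec', ht', hs''⟩ := h' s' hs'
  exact ⟨_, _, .seq hexec hexec', by simpa using Nat.add_le_add ht ht', hs''⟩

theorem nset {a e : NExp} (h : post (s.setNat (a.eval s) (e.eval s))) :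
    Runs O q (.nset a e) s (a.cost + e.cost + 1 : ℕ) post :=
  ⟨_, _, .nset s a e, by simp, h⟩

theorem rset {a : NExp} {e : RExp} (h : post (s.setReal (a.eval s) (e.eval s))) :
    Runs O q (.rset a e) s (a.cost + e.cost + 1 : ℕ) post :=
  ⟨_, _, .rset s a e, by simp, h⟩

theorem ite {b : BExp} (h : b.holds s → Runs O q P s f post)
    (h' : ¬ b.holds s → Runs O q P' s g post) :
    Runs O q (.ite b P P') s ((b.cost + 1 : ℕ) + f + g) post := by
  by_cases hb : b.holds s
  · obtain ⟨t, s', hexec, ht, hs'⟩ := h hb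
    exact ⟨_, _, .ite_true hb hexec, by simp; omega, hs'⟩
  · obtain ⟨t, s', hexec, ht, hs'⟩ := h' hb
    exact ⟨_, _, .ite_false hb hexec, by simp; omega, hs'⟩

theorem loop {b : BExp} (I : Mem → Prop) (μ : Mem → ℕ)
    (hP : ∀ s, I s → b.holds s → Runs O q P s f (fun s' => I s' ∧ μ s' < μ s))
    (hs : I s) (hμ : μ s ≤ g.eval q) :
    Runs O q (.loop b P) s (g * (f + (b.cost + 1 : ℕ)) + (b.cost + 1 : ℕ))
      (fun s' => I s' ∧ ¬ b.holds s') := by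
  suffices H : ∀ N s, μ s ≤ N → I s → ∃ t s', Exec O (.loop b P) s t s' ∧
      t ≤ N * (f.eval q + (b.cost + 1)) + (b.cost + 1) ∧ I s' ∧ ¬ b.holds s' by
    simpa [Runs] using H _ s hμ hs
  intro N
  induction N with
  | zero =>
    intro s hN hs
    by_cases hb : b.holds s
    · obtain ⟨_, _, _, _, _, hlt⟩ := hP s hs hb
      omega
    · exact ⟨_, _, .loop_done hb, by omega, hs, hb⟩
  | succ N ih =>
    intro s hN hs
    by_cases hb : b.holds s
    · obtain ⟨t, s', hexec, ht, hs', hlt⟩ := hP s hs hb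
      obtain ⟨t', s'', hexec', ht', hs''⟩ := ih s' (by omega) hs'
      exact ⟨_, _, .loop_step hb hexec hexec', by rw [Nat.add_mul]; omega, hs''⟩
    · exact ⟨_, _, .loop_done hb, by omega, hs, hb⟩

/-- The running time of `Prog.forN v e P` when `P` takes time `f` and `e` evaluates to at most
`g(q)`. -/
noncomputable def forBound (v : ℕ) (e : NExp) (f g : ℕ[X]) : ℕ[X] :=
  ((NExp.const v).cost + (NExp.const 0).cost + 1 : ℕ) +
    (g * (f + ((NExp.const v).cost + (NExp.var v + .const 1).cost + 1 : ℕ) +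
      ((BExp.nlt (.var v) e).cost + 1 : ℕ)) + ((BExp.nlt (.var v) e).cost + 1 : ℕ))

theorem forN {v B : ℕ} {e : NExp} (I : ℕ → Mem → Prop) (h0 : I 0 (s.setNat v 0))
    (hB : B ≤ g.eval q) (he : ∀ j s', I j s' → e.eval s' = B)
    (hP : ∀ j < B, ∀ s', I j s' → s'.nat v = j →
      Runs O q P s' f (fun s'' => s''.nat v = j ∧ I (j + 1) (s''.setNat v (j + 1)))) :
    Runs O q (Prog.forN v e P) s (forBound v e f g) (I B) := by
  refine Runs.seq (Runs.nset (post := fun s' => s' = s.setNat v 0) rfl) ?_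
  rintro _ rfl
  refine (Runs.loop (fun s' => ∃ j ≤ B, s'.nat v = j ∧ I j s') (fun s' => B - s'.nat v) ?_
    ⟨0, Nat.zero_le _, by simp, h0⟩ ((Nat.sub_le _ _).trans hB)).mono ?_
  · rintro s' ⟨j, -, hv, hI⟩ hlt
    simp only [BExp.holds, NExp.eval_var, hv, he j s' hI] at hlt
    refine Runs.seq (hP j hlt s' hI hv) fun s'' ⟨hv', hI'⟩ => Runs.nset ?_
    simp only [NExp.eval_const, NExp.eval_add, NExp.eval_var, hv', Mem.setNat_nat, if_true, hv]
    exact ⟨⟨j + 1, hlt, rfl, hI'⟩, by omega⟩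
  · rintro s' ⟨⟨j, hj, hv, hI⟩, hn⟩
    simp only [BExp.holds, NExp.eval_var, hv, he j s' hI] at hn
    obtain rfl : j = B := by omega
    exact hI

/-- The running time of `Prog.nest v e P m` when `P` takes time `f` and `e` evaluates to at most
`g(q)`. -/
noncomputable def nestBound (v : ℕ) (e : NExp) (f g : ℕ[X]) : ℕ → ℕ[X]
  | 0 => f
  | m + 1 => forBound (v + m) e (nestBound v e f g m) g

theorem digit_eq_of_mem_block {B m a j τ : ℕ} (hj : j < B) (h : B ^ m * (B * a + j) ≤ τ)
    (h' : τ < B ^ m * (B * a + (j + 1))) : τ / B ^ m % B = j := by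
  have hdiv : τ / B ^ m = B * a + j :=
    Nat.div_eq_of_lt_le (by rwa [mul_comm]) (by rwa [mul_comm, add_assoc])
  rw [hdiv, Nat.mul_add_mod, Nat.mod_eq_of_lt hj]

/-- The counters of nested loops are the base-`B` digits of the number `τ` of passes made. -/
theorem nest {v B m τ₀ : ℕ} {e : NExp} (I : ℕ → Mem → Prop) (h0 : I τ₀ s) (hτ₀ : B ^ m ∣ τ₀)
    (hB : B ≤ g.eval q) (he : ∀ τ s', I τ s' → e.eval s' = B)
    (hI : ∀ τ s' j x, j < m → I τ s' → I τ (s'.setNat (v + j) x))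
    (hP : ∀ τ s', τ₀ ≤ τ → τ < τ₀ + B ^ m → I τ s' →
      (∀ j < m, s'.nat (v + j) = τ / B ^ j % B) →
      Runs O q P s' f (fun s'' => (∀ j < m, s''.nat (v + j) = s'.nat (v + j)) ∧ I (τ + 1) s'')) :
    Runs O q (Prog.nest v e P m) s (nestBound v e f g m) (I (τ₀ + B ^ m)) := by
  induction m generalizing I τ₀ s with
  | zero => exact (hP τ₀ s le_rfl (by simp) h0 (by simp)).mono fun s' h => by simpa using h.2
  | succ m ih =>
    obtain ⟨a, rfl⟩ := hτ₀
    have hstart : B ^ (m + 1) * a = B ^ m * (B * a + 0) := by ring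
    have hend : B ^ (m + 1) * a + B ^ (m + 1) = B ^ m * (B * a + B) := by ring
    rw [hend] at hP ⊢
    rw [hstart] at h0 hP
    refine Runs.forN (fun j => I (B ^ m * (B * a + j))) (hI _ _ m 0 (by omega) h0) hB
      (fun j s' => he _ s') fun j hj s' hs' hv => ?_
    have hnext : B ^ m * (B * a + j) + B ^ m = B ^ m * (B * a + (j + 1)) := by ring
    have hmono : ∀ {x y}, x ≤ y → B ^ m * (B * a + x) ≤ B ^ m * (B * a + y) :=
      fun h => Nat.mul_le_mul_left _ (by omega)
    refine (ih (fun τ s'' => I τ s'' ∧ s''.nat (v + m) = j) ⟨hs', hv⟩ ⟨_, rfl⟩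
      (fun τ s'' h => he τ s'' h.1) (fun τ s'' l x hl h => ⟨hI τ s'' l x (by omega) h.1, by
        rw [Mem.setNat_nat, if_neg (by omega), h.2]⟩) ?_).mono ?_
    · rintro τ s'' hτ hτ' ⟨hs'', hv'⟩ hdigits
      rw [hnext] at hτ'
      refine (hP τ s'' ((hmono j.zero_le).trans hτ) (hτ'.trans_le (hmono hj)) hs'' fun l hl =>
        ?_).mono fun r ⟨hr, hr'⟩ => ⟨fun l hl => hr l (by omega), hr', (hr m (by omega)).trans hv'⟩
      rcases Nat.lt_succ_iff_lt_or_eq.mp hl with hl | rfl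
      exacts [hdigits l hl, hv'.trans (digit_eq_of_mem_block hj hτ hτ').symm]
    · rintro s'' ⟨hs'', hv'⟩
      exact ⟨hv', hI _ _ m _ (by omega) (hnext ▸ hs'')⟩

theorem seqs {m : ℕ} {P : Fin m → Prog n} {f : Fin m → ℕ[X]} (I : ℕ → Mem → Prop) (h0 : I 0 s)
    (hP : ∀ (i : Fin m) s', I i s' → Runs O q (P i) s' (f i) (I (i + 1))) :
    Runs O q (Prog.seqs P) s (1 + ∑ i, f i) (I m) := by
  induction m with
  | zero => simpa [Prog.seqs] using Runs.skip h0
  | succ m ih =>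
    rw [Prog.seqs, Fin.foldl_succ_last, Fin.sum_univ_castSucc, ← add_assoc]
    exact Runs.seq (ih fun i => hP i.castSucc) (hP (Fin.last m))

end Runs

/-! ### Matrices with the Frobenius norm -/

/-- Matrices with the Frobenius norm. -/
abbrev Mat (d k : ℕ) : Type := EuclideanSpace ℝ (Fin d × Fin k)

/-- The rank-one matrix `a mᵀ`. -/
noncomputable def outer {d k : ℕ} (a : Vec d) (m : Fin k → ℝ) : Mat d k :=
  WithLp.toLp 2 (fun p => a p.1 * m p.2)

/-- The matrix-vector product `K m`. -/
noncomputable def app {d k : ℕ} (K : Mat d k) (m : Fin k → ℝ) : Vec d :=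
  WithLp.toLp 2 (fun c => ∑ j, K (c, j) * m j)

section Matrices

variable {d k : ℕ}

theorem inner_outer (a : Vec d) (m : Fin k → ℝ) (K : Mat d k) :
    inner ℝ (outer a m) K = inner ℝ a (app K m) := by
  simp only [PiLp.inner_apply, outer, app, RCLike.inner_apply, conj_trivial,
    Fintype.sum_prod_type, Finset.sum_mul]
  exact Finset.sum_congr rfl fun c _ => Finset.sum_congr rfl fun j _ => by ring

theorem norm_outer_sq (a : Vec d) (m : Fin k → ℝ) :
    ‖outer a m‖ ^ 2 = ‖a‖ ^ 2 * ∑ j, m j ^ 2 := by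
  simp only [EuclideanSpace.norm_sq_eq, outer, Real.norm_eq_abs, sq_abs, Fintype.sum_prod_type,
    mul_pow, Finset.sum_mul_sum]

theorem app_smul (r : ℝ) (K : Mat d k) (m : Fin k → ℝ) : app (r • K) m = r • app K m := by
  ext c
  simp [app, Finset.mul_sum, mul_assoc]

theorem app_sub (K K' : Mat d k) (m : Fin k → ℝ) : app (K - K') m = app K m - app K' m := by
  ext c
  simp [app, sub_mul, Finset.sum_sub_distrib]

theorem app_zero (m : Fin k → ℝ) : app (0 : Mat d k) m = 0 := by
  ext c
  simp [app]

end Matrices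

section Cut

theorem norm_sub_smul_sq_le {E : Type*} [NormedAddCommGroup E] [InnerProductSpace ℝ E]
    {v w : E} {c L : ℝ} (hc : 0 ≤ c) (hL : 0 < L) (hcw : c ≤ inner ℝ w v) (hw : ‖w‖ ^ 2 ≤ L) :
    ‖v - (c / L) • w‖ ^ 2 ≤ ‖v‖ ^ 2 - c ^ 2 / L := by
  have hinner : c / L * c ≤ c / L * inner ℝ w v := by gcongr
  have hnorm : (c / L) ^ 2 * ‖w‖ ^ 2 ≤ (c / L) ^ 2 * L := by gcongr
  have hcL : (c / L) ^ 2 * L = c ^ 2 / L := by field_simp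
  have hcL' : c / L * c = c ^ 2 / L := by ring
  rw [norm_sub_sq_real, inner_smul_right, norm_smul, mul_pow, Real.norm_eq_abs, sq_abs,
    real_inner_comm]
  linarith

theorem norm_le_of_support {E : Type*} [NormedAddCommGroup E] [InnerProductSpace ℝ E] {X : Set E}
    (hX : Metric.closedBall 0 1 ⊆ X) {a : E} {b : ℝ} (h : ∀ z ∈ X, inner ℝ a z ≤ b) : ‖a‖ ≤ b := by
  obtain rfl | ha := eq_or_ne a 0
  · simpa using h 0 (hX (by simp))
  · have hn : ‖a‖ ≠ 0 := norm_ne_zero_iff.2 ha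
    have hunit := h (‖a‖⁻¹ • a) (hX (by simp [norm_smul, hn]))
    rw [inner_smul_right, real_inner_self_eq_norm_sq] at hunit
    calc ‖a‖ = ‖a‖⁻¹ * ‖a‖ ^ 2 := by field_simp
      _ ≤ b := hunit

variable {d k : ℕ}

/-- Shrinking the comparator by `1 - 1/M` moves `K' m` away from the separating hyperplane by at
least `b/M`, which is the progress made by the cut. -/
theorem norm_cut_sub_sq_le {X : Set (Vec d)} (hX : Metric.closedBall 0 1 ⊆ X) {a : Vec d} {b : ℝ}
    (h : ∀ z ∈ X, inner ℝ a z ≤ b) {K K' : Mat d k} {m : Fin k → ℝ}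
    (hK : b < inner ℝ a (app K m)) (hK' : app K' m ∈ X) {M B : ℝ} (hM : 1 ≤ M) (hB : 0 < B)
    (hm : ∑ j, m j ^ 2 ≤ B) :
    ‖K - (b / (‖a‖ ^ 2 * (M * B))) • outer a m - (1 - 1 / M) • K'‖ ^ 2 ≤
      ‖K - (1 - 1 / M) • K'‖ ^ 2 - 1 / (M ^ 2 * B) := by
  have hab : ‖a‖ ≤ b := norm_le_of_support hX h
  have ha : 0 < ‖a‖ := norm_pos_iff.2 fun ha => by
    subst ha
    simp only [inner_zero_left, norm_zero] at hK hab
    linarith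
  have hshrink : 0 ≤ 1 - 1 / M := sub_nonneg.2 ((div_le_one (by linarith)).2 hM)
  have hinner : b / M ≤ inner ℝ (outer a m) (K - (1 - 1 / M) • K') := by
    rw [inner_outer, app_sub, app_smul, inner_sub_right, inner_smul_right]
    have := mul_le_mul_of_nonneg_left (h _ hK') hshrink
    linarith [show (1 - 1 / M) * b = b - b / M by ring]
  have hnorm : ‖outer a m‖ ^ 2 ≤ ‖a‖ ^ 2 * B := by rw [norm_outer_sq]; gcongr
  have hcut := norm_sub_smul_sq_le (div_nonneg (ha.le.trans hab) (by linarith))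
    (by positivity) hinner hnorm
  have hstep : b / M / (‖a‖ ^ 2 * B) = b / (‖a‖ ^ 2 * (M * B)) := by
    rw [div_div]; congr 1; ring
  have hgain : 1 / (M ^ 2 * B) ≤ (b / M) ^ 2 / (‖a‖ ^ 2 * B) := by
    rw [div_le_div_iff₀ (by positivity) (by positivity), div_pow]
    have : ‖a‖ ^ 2 ≤ b ^ 2 := by gcongr
    calc 1 * (‖a‖ ^ 2 * B) ≤ b ^ 2 * B := by rw [one_mul]; gcongr
      _ = b ^ 2 / M ^ 2 * (M ^ 2 * B) := by field_simp
  rw [← hstep, sub_right_comm]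
  linarith

end Cut

section GradientStep

variable {d k : ℕ} {ι : Type*} [Fintype ι] {M B R : ℝ} {g : ι → Vec d} {f : ι → Fin k → ℝ}

theorem norm_sum_outer_sq_le (hB : 0 ≤ B) (hg : ∀ τ, ‖g τ‖ ≤ 1) (hf : ∀ τ, ∑ j, f τ j ^ 2 ≤ B) :
    ‖∑ τ, outer (g τ) (f τ)‖ ^ 2 ≤ (Fintype.card ι : ℝ) ^ 2 * B := by
  have hterm : ∀ τ, ‖outer (g τ) (f τ)‖ ≤ √B := fun τ => by
    apply Real.le_sqrt_of_sq_le
    rw [norm_outer_sq]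
    exact (mul_le_of_le_one_left (by positivity) (pow_le_one₀ (norm_nonneg _) (hg τ))).trans (hf τ)
  calc ‖∑ τ, outer (g τ) (f τ)‖ ^ 2 ≤ (∑ _τ : ι, √B) ^ 2 := by
        gcongr
        exact norm_sum_le_of_le _ fun τ _ => hterm τ
    _ = (Fintype.card ι : ℝ) ^ 2 * B := by
        rw [Finset.sum_const, Finset.card_univ, nsmul_eq_mul, mul_pow, Real.sq_sqrt hB]

theorem norm_gradient_step_sub_sq_le [Nonempty ι] (hM : 0 < M) (hB : 0 < B)
    (hg : ∀ τ, ‖g τ‖ ≤ 1) (hf : ∀ τ, ∑ j, f τ j ^ 2 ≤ B) (K K' : Mat d k) :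
    ‖K + (1 / (B * M * Fintype.card ι)) • ∑ τ, outer (g τ) (f τ) - K'‖ ^ 2 ≤
      ‖K - K'‖ ^ 2 + 2 / (B * M * Fintype.card ι) *
        ∑ τ, inner ℝ (g τ) (app K (f τ) - app K' (f τ)) + 1 / (B * M ^ 2) := by
  have hN : (0 : ℝ) < Fintype.card ι := by exact_mod_cast Fintype.card_pos
  set N : ℝ := (Fintype.card ι : ℝ)
  have hsecond : (1 / (B * M * N)) ^ 2 * ‖∑ τ, outer (g τ) (f τ)‖ ^ 2 ≤ 1 / (B * M ^ 2) :=
    calc _ ≤ (1 / (B * M * N)) ^ 2 * (N ^ 2 * B) := by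
          gcongr
          exact norm_sum_outer_sq_le hB.le hg hf
      _ = 1 / (B * M ^ 2) := by field_simp
  rw [add_sub_right_comm, norm_add_sq_real, inner_smul_right, real_inner_comm, sum_inner,
    norm_smul, mul_pow, Real.norm_eq_abs, sq_abs]
  simp only [inner_outer, app_sub]
  linarith [show 2 / (B * M * N) * ∑ τ, inner ℝ (g τ) (app K (f τ) - app K' (f τ)) =
    2 * (1 / (B * M * N) * ∑ τ, inner ℝ (g τ) (app K (f τ) - app K' (f τ))) by ring]

theorem sum_inner_sub_le [Nonempty ι] (hM : 0 < M) (hB : 0 < B)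
    (hg : ∀ τ, ‖g τ‖ ≤ 1) (hf : ∀ τ, ∑ j, f τ j ^ 2 ≤ B) (K K' : Mat d k) :
    ∑ τ, inner ℝ (g τ) (app K' (f τ) - app K (f τ)) ≤
      Fintype.card ι * B * M / 2 * (‖K - K'‖ ^ 2 -
        ‖K + (1 / (B * M * Fintype.card ι)) • ∑ τ, outer (g τ) (f τ) - K'‖ ^ 2) +
      Fintype.card ι / (2 * M) := by
  have hN : (0 : ℝ) < Fintype.card ι := by exact_mod_cast Fintype.card_pos
  have hstep := norm_gradient_step_sub_sq_le hM hB hg hf K K'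
  have hneg : ∑ τ, inner ℝ (g τ) (app K' (f τ) - app K (f τ)) =
      -∑ τ, inner ℝ (g τ) (app K (f τ) - app K' (f τ)) := by
    simp only [← Finset.sum_neg_distrib, ← inner_neg_right, neg_sub]
  set N : ℝ := (Fintype.card ι : ℝ)
  set A := ∑ τ, inner ℝ (g τ) (app K (f τ) - app K' (f τ))
  set a₁ := ‖K + (1 / (B * M * N)) • ∑ τ, outer (g τ) (f τ) - K'‖ ^ 2
  have hscaled : N * B * M / 2 * a₁ ≤ N * B * M / 2 *
      (‖K - K'‖ ^ 2 + 2 / (B * M * N) * A + 1 / (B * M ^ 2)) := by gcongr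
  have hexpand : N * B * M / 2 * (‖K - K'‖ ^ 2 + 2 / (B * M * N) * A + 1 / (B * M ^ 2)) =
      N * B * M / 2 * ‖K - K'‖ ^ 2 + A + N / (2 * M) := by field_simp
  rw [hneg]
  linarith

theorem norm_gradient_step_sq_le [Nonempty ι] (hM : 1 ≤ M) (hB : 1 ≤ B)
    (hg : ∀ τ, ‖g τ‖ ≤ 1) (hf : ∀ τ, ∑ j, f τ j ^ 2 ≤ B) (K : Mat d k)
    (hK : ∀ τ, ‖app K (f τ)‖ ≤ R) :
    ‖K + (1 / (B * M * Fintype.card ι)) • ∑ τ, outer (g τ) (f τ)‖ ^ 2 ≤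
      ‖K‖ ^ 2 + (2 * R + 1) := by
  have : (0 : ℝ) < Fintype.card ι := by exact_mod_cast Fintype.card_pos
  have hR : 0 ≤ R := (norm_nonneg _).trans (hK (Classical.arbitrary ι))
  have hstep := norm_gradient_step_sub_sq_le (zero_lt_one.trans_le hM) (zero_lt_one.trans_le hB)
    hg hf K 0
  simp only [sub_zero, app_zero] at hstep
  have hsum : ∑ τ, inner ℝ (g τ) (app K (f τ)) ≤ Fintype.card ι * R := by
    refine (Finset.sum_le_sum fun τ _ => ?_).trans_eq (by simp : ∑ _τ : ι, R = _)
    calc inner ℝ (g τ) (app K (f τ)) ≤ ‖g τ‖ * ‖app K (f τ)‖ := real_inner_le_norm _ _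
      _ ≤ R := (mul_le_of_le_one_left (norm_nonneg _) (hg τ)).trans (hK τ)
  have hfirst : 2 / (B * M * Fintype.card ι) * ∑ τ, inner ℝ (g τ) (app K (f τ)) ≤ 2 * R :=
    calc _ ≤ 2 / (B * M * Fintype.card ι) * (Fintype.card ι * R) := by gcongr
      _ = 2 * R / (B * M) := by field_simp
      _ ≤ 2 * R := div_le_self (by positivity) (one_le_mul_of_one_le_of_one_le hB hM)
  have hsecond : 1 / (B * M ^ 2) ≤ 1 :=
    div_le_one_of_le₀ (one_le_mul_of_one_le_of_one_le hB (one_le_pow₀ hM)) (by positivity)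
  linarith

end GradientStep

/-! ### Regret of a round -/

/-- The first `M` points produced from `x 0` by iterating `y ↦ K m(y)` lie in `X`. -/
structure IsTrajectory {d k : ℕ} (X : Set (Vec d)) (m : Vec d → Fin k → ℝ) (K : Mat d k)
    (x : ℕ → Vec d) (M : ℕ) : Prop where
  mem : ∀ l ≤ M, x l ∈ X
  step : ∀ l < M, x (l + 1) = app K (m (x l))

/-- Player `i`'s gain from applying the deviation `φ` at the profile `x`. -/
def ConcaveGame.gain {n : ℕ} (Γ : ConcaveGame n) (i : Fin n) (φ : Vec (Γ.d i) → Vec (Γ.d i))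
    (x : Profile Γ.d) : ℝ :=
  Γ.u i (Function.update x i (φ (x i))) - Γ.u i x

/-- The profile picked out of the sequences `x` by the times `ℓ`. -/
def pick {n : ℕ} {d : Fin n → ℕ} (x : (i : Fin n) → ℕ → Vec (d i)) (ℓ : Fin n → ℕ) : Profile d :=
  fun i => x i (ℓ i)

/-- The profile `pick x ℓ` with player `i` moved one time step ahead. -/
def advance {n : ℕ} {d : Fin n → ℕ} (x : (i : Fin n) → ℕ → Vec (d i)) (ℓ : Fin n → ℕ)
    (i : Fin n) : Profile d :=
  Function.update (pick x ℓ) i (x i (ℓ i + 1))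

/-- The contribution of the times `ℓ` to the gradient step for player `i`'s matrix. -/
noncomputable def roundGradient {n : ℕ} {d k : Fin n → ℕ} (O : Oracles d k)
    (m : (i : Fin n) → Vec (d i) → Fin (k i) → ℝ) (x : (i : Fin n) → ℕ → Vec (d i)) (i : Fin n)
    (ℓ : Fin n → ℕ) : Mat (d i) (k i) :=
  outer (O.grad i (advance x ℓ i)) (m i (x i (ℓ i)))

section Game

variable {n M : ℕ} {Γ : ConcaveGame n} {x : (i : Fin n) → ℕ → Vec (Γ.d i)} {i : Fin n}

theorem ConcaveGame.update_mem_profiles {y : Profile Γ.d} (hy : y ∈ Γ.profiles) {z : Vec (Γ.d i)}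
    (hz : z ∈ Γ.X i) : Function.update y i z ∈ Γ.profiles := fun j => by
  by_cases hj : j = i
  · subst hj; simpa using hz
  · simpa [hj] using hy j

theorem sum_sum_update (i : Fin n) (F : (Fin n → Fin M) → ℝ) :
    ∑ ℓ : Fin n → Fin M, ∑ r : Fin M, F (Function.update ℓ i r) = M * ∑ ℓ, F ℓ := by
  have hswap : ∑ q : (Fin n → Fin M) × Fin M, F (Function.update q.1 i q.2) =
      ∑ q : (Fin n → Fin M) × Fin M, F q.1 := by
    refine Finset.sum_bij' (fun q _ => (Function.update q.1 i q.2, q.1 i))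
      (fun q _ => (Function.update q.1 i q.2, q.1 i)) ?_ ?_ ?_ ?_ ?_ <;> simp
  rw [Fintype.sum_prod_type, Fintype.sum_prod_type] at hswap
  rw [hswap]
  simp [Finset.mul_sum]

theorem pick_mem_profiles (hx : ∀ j, ∀ l ≤ M, x j l ∈ Γ.X j) {ℓ : Fin n → ℕ}
    (hℓ : ∀ j, ℓ j ≤ M) : pick x ℓ ∈ Γ.profiles :=
  fun j => hx j _ (hℓ j)

theorem pick_update (x : (i : Fin n) → ℕ → Vec (Γ.d i)) (ℓ : Fin n → Fin M) (i : Fin n)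
    (r : Fin M) : pick x (fun j => (Function.update ℓ i r j : ℕ)) =
      Function.update (pick x fun j => ℓ j) i (x i r) := by
  funext j
  by_cases hj : j = i
  · subst hj; simp [pick]
  · simp [pick, hj]

/-- Summed over `ℓ i` with the other times fixed, the increments telescope to a difference of two
utilities. -/
theorem sum_advance_sub_pick_le (hM : 0 < M) (hx : ∀ j, ∀ l ≤ M, x j l ∈ Γ.X j) (i : Fin n) :
    ∑ ℓ : Fin n → Fin M, (Γ.u i (advance x (fun j => ℓ j) i) - Γ.u i (pick x fun j => ℓ j)) ≤
      (M : ℝ) ^ n / M := by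
  rw [le_div_iff₀ (by exact_mod_cast hM), mul_comm, ← sum_sum_update i]
  refine (Finset.sum_le_sum fun ℓ _ => ?_).trans_eq (by simp : ∑ _ℓ : Fin n → Fin M, (1 : ℝ) = _)
  set v : ℕ → ℝ := fun l => Γ.u i (Function.update (pick x fun j => ℓ j) i (x i l))
  have hv : ∀ l ≤ M, v l ∈ Set.Icc (0 : ℝ) 1 := fun l hl =>
    Γ.u_mem i _ (Γ.update_mem_profiles (pick_mem_profiles hx fun j => (ℓ j).2.le) (hx i l hl))
  have htelescope : ∑ r : Fin M, (v (r + 1) - v r) = v M - v 0 := by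
    rw [← Finset.sum_range_sub v M, Finset.sum_range]
  simp only [advance, pick_update, Function.update_idem, Function.update_self]
  linarith [(hv M le_rfl).2, (hv 0 M.zero_le).1]

variable {k : Fin n → ℕ} {m : (i : Fin n) → Vec (Γ.d i) → Fin (k i) → ℝ} {O : Oracles Γ.d k}

/-- Shrinking a strategy by `1 - δ` costs at most `δ` in utility; the rest is the supergradient
inequality at `z`. -/
theorem Oracles.Correct.utility_update_le (hO : O.Correct Γ m) (h0 : (0 : Vec (Γ.d i)) ∈ Γ.X i)
    {y : Profile Γ.d} (hy : y ∈ Γ.profiles) {w z : Vec (Γ.d i)} (hw : w ∈ Γ.X i) (hz : z ∈ Γ.X i)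
    {δ : ℝ} (hδ0 : 0 ≤ δ) (hδ1 : δ ≤ 1) :
    Γ.u i (Function.update y i w) ≤ δ +
      inner ℝ (O.grad i (Function.update y i z)) ((1 - δ) • w - z) +
      Γ.u i (Function.update y i z) := by
  have hconcave := (Γ.concave_u i y hy).2 hw h0 (sub_nonneg.2 hδ1) hδ0 (by ring)
  have hshrunk := Γ.convex_X i hw h0 (sub_nonneg.2 hδ1) hδ0 (by ring)
  simp only [smul_zero, add_zero, smul_eq_mul] at hconcave hshrunk
  have hsuper := hO.grad_super i _ (Γ.update_mem_profiles hy hz) _ hshrunk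
  rw [Function.update_idem, Function.update_self] at hsuper
  have hw1 := mul_le_of_le_one_right hδ0 (Γ.u_mem i _ (Γ.update_mem_profiles hy hw)).2
  have h00 := mul_nonneg hδ0 (Γ.u_mem i _ (Γ.update_mem_profiles hy h0)).1
  linarith

theorem gain_pick_le (hO : O.Correct Γ m) (h0 : (0 : Vec (Γ.d i)) ∈ Γ.X i)
    (hx : ∀ j, ∀ l ≤ M, x j l ∈ Γ.X j) {K K' : Mat (Γ.d i) (k i)}
    (hK : IsTrajectory (Γ.X i) (m i) K (x i) M) {φ : Vec (Γ.d i) → Vec (Γ.d i)}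
    (hφ : Set.MapsTo φ (Γ.X i) (Γ.X i)) (hK' : ∀ y ∈ Γ.X i, φ y = app K' (m i y))
    (ℓ : Fin n → Fin M) :
    Γ.gain i φ (pick x fun j => ℓ j) ≤ 1 / M +
      inner ℝ (O.grad i (advance x (fun j => ℓ j) i)) (app ((1 - 1 / (M : ℝ)) • K')
        (m i (x i (ℓ i))) - app K (m i (x i (ℓ i)))) +
      (Γ.u i (advance x (fun j => ℓ j) i) - Γ.u i (pick x fun j => ℓ j)) := by
  have hM : (1 : ℝ) ≤ M := by exact_mod_cast (ℓ i).pos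
  have hxi := hx i (ℓ i) (ℓ i).2.le
  have hupdate := hO.utility_update_le h0 (pick_mem_profiles hx fun j => (ℓ j).2.le) (hφ hxi)
    (hx i (ℓ i + 1) (ℓ i).2) (δ := 1 / M) (by positivity)
    (div_le_one_of_le₀ hM (by positivity))
  rw [app_smul, ← hK' _ hxi, ← hK.step _ (ℓ i).2]
  simp only [ConcaveGame.gain, advance, pick] at hupdate ⊢
  linarith

theorem sum_gain_le (hO : O.Correct Γ m) (hM : 0 < M) {B : ℝ} (hB : 0 < B)
    (h0 : (0 : Vec (Γ.d i)) ∈ Γ.X i) (hmB : ∀ y ∈ Γ.X i, ∑ j, m i y j ^ 2 ≤ B)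
    (hx : ∀ j, ∀ l ≤ M, x j l ∈ Γ.X j) {K K' : Mat (Γ.d i) (k i)}
    (hK : IsTrajectory (Γ.X i) (m i) K (x i) M) {φ : Vec (Γ.d i) → Vec (Γ.d i)}
    (hφ : Set.MapsTo φ (Γ.X i) (Γ.X i)) (hK' : ∀ y ∈ Γ.X i, φ y = app K' (m i y)) :
    ∑ ℓ : Fin n → Fin M, Γ.gain i φ (pick x fun j => ℓ j) ≤
      (M : ℝ) ^ n * (5 / (2 * M)) + (M : ℝ) ^ n * B * M / 2 * (‖K - (1 - 1 / (M : ℝ)) • K'‖ ^ 2 -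
        ‖K + (1 / (B * M * (M : ℝ) ^ n)) • ∑ ℓ : Fin n → Fin M, roundGradient O m x i (ℓ ·) -
          (1 - 1 / (M : ℝ)) • K'‖ ^ 2) := by
  have : Nonempty (Fin n → Fin M) := ⟨fun _ => ⟨0, hM⟩⟩
  have hM0 : (0 : ℝ) < M := by exact_mod_cast hM
  have hcard : (Fintype.card (Fin n → Fin M) : ℝ) = (M : ℝ) ^ n := by simp
  have hgradient := sum_inner_sub_le hM0 hB
    (g := fun ℓ : Fin n → Fin M => O.grad i (advance x (fun j => ℓ j) i))
    (f := fun ℓ => m i (x i (ℓ i)))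
    (fun ℓ => hO.grad_norm i _ (Γ.update_mem_profiles
      (pick_mem_profiles hx fun j => (ℓ j).2.le) (hx i _ (ℓ i).2)))
    (fun ℓ => hmB _ (hx i _ (ℓ i).2.le)) K ((1 - 1 / (M : ℝ)) • K')
  have hsum := Finset.sum_le_sum fun ℓ (_ : ℓ ∈ Finset.univ) =>
    gain_pick_le hO h0 hx hK hφ hK' ℓ
  rw [Finset.sum_add_distrib, Finset.sum_add_distrib, Finset.sum_const, Finset.card_univ,
    nsmul_eq_mul, hcard] at hsum
  rw [hcard] at hgradient
  have htelescope := sum_advance_sub_pick_le hM hx i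
  simp only [roundGradient]
  linarith [show (M : ℝ) ^ n * (5 / (2 * M)) =
    (M : ℝ) ^ n * (1 / M) + (M : ℝ) ^ n / M + (M : ℝ) ^ n / (2 * M) by field_simp; norm_num]

theorem norm_round_sq_le (hO : O.Correct Γ m) (hM : 0 < M) {B R : ℝ} (hB : 1 ≤ B)
    (hmB : ∀ y ∈ Γ.X i, ∑ j, m i y j ^ 2 ≤ B) (hR : ∀ y ∈ Γ.X i, ‖y‖ ≤ R)
    (hx : ∀ j, ∀ l ≤ M, x j l ∈ Γ.X j) {K : Mat (Γ.d i) (k i)}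
    (hK : IsTrajectory (Γ.X i) (m i) K (x i) M) :
    ‖K + (1 / (B * M * (M : ℝ) ^ n)) • ∑ ℓ : Fin n → Fin M, roundGradient O m x i (ℓ ·)‖ ^ 2 ≤
      ‖K‖ ^ 2 + (2 * R + 1) := by
  have : Nonempty (Fin n → Fin M) := ⟨fun _ => ⟨0, hM⟩⟩
  have hstep := norm_gradient_step_sq_le (by exact_mod_cast hM : (1 : ℝ) ≤ M) hB
    (g := fun ℓ : Fin n → Fin M => O.grad i (advance x (fun j => ℓ j) i))
    (f := fun ℓ => m i (x i (ℓ i)))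
    (fun ℓ => hO.grad_norm i _ (Γ.update_mem_profiles
      (pick_mem_profiles hx fun j => (ℓ j).2.le) (hx i _ (ℓ i).2)))
    (fun ℓ => hmB _ (hx i _ (ℓ i).2.le)) K
    (fun ℓ => by rw [← hK.step _ (ℓ i).2]; exact hR _ (hx i _ (ℓ i).2))
  simpa [roundGradient] using hstep

end Game

/-! ### The memory layout -/

theorem add_mul_inj {b x x' y y' : ℕ} (hx : x < b) (hx' : x' < b) (h : x + b * y = x' + b * y') :
    x = x' ∧ y = y' := by
  have hmod := congrArg (· % b) h
  have hdiv := congrArg (· / b) h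
  simp only [Nat.add_mul_mod_self_left, Nat.mod_eq_of_lt hx, Nat.mod_eq_of_lt hx',
    Nat.add_mul_div_left _ _ (Nat.zero_lt_of_lt hx), Nat.div_eq_of_lt hx,
    Nat.div_eq_of_lt hx', zero_add] at hmod hdiv
  exact ⟨hmod, hdiv⟩

/-- The sizes of an instance. The algorithm is run with the single size parameter `Q`: trajectories
have length `Q`, and `Q ^ 7` rounds of `Q ^ n` points each are played. -/
structure Params {n : ℕ} (d k : Fin n → ℕ) where
  Q : ℕ
  sum_d_lt : ∑ i, d i < Q
  sum_k_lt : ∑ i, k i < Q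

namespace Params

variable {n : ℕ} {d k : Fin n → ℕ} (p : Params d k)

/-- The number of points of the distribution that is output. -/
def points : ℕ := p.Q ^ (n + 7)

/-- The number of real cells taken by an output point and its probability. -/
def stride (_ : Params d k) : ℕ := 1 + ∑ i, d i

/-- The cells behind the output area, as an array of rows of length `Q`: every player `i` owns five
two-dimensional tables, and this is entry `o` of row `row` in her table number `a`. The three cells
left out in between make sure that the tables do not contain the inputs `ε`, `R`, `D`. -/
def cell (a : ℕ) (i : Fin n) (row o : ℕ) : ℕ :=
  p.points * p.stride + 3 + (p.Q * (a + 5 * (i + n * row)) + o)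

theorem d_lt (i : Fin n) : d i < p.Q :=
  (Finset.single_le_sum (fun _ _ => Nat.zero_le _) (Finset.mem_univ i)).trans_lt p.sum_d_lt

theorem k_lt (i : Fin n) : k i < p.Q :=
  (Finset.single_le_sum (fun _ _ => Nat.zero_le _) (Finset.mem_univ i)).trans_lt p.sum_k_lt

theorem Q_pos : 0 < p.Q := (Nat.zero_le _).trans_lt p.sum_d_lt

/-- The variables of the algorithm: the output, and for each player a matrix, a trajectory, the
features along the trajectory, a vector and a number holding the last oracle answer, and an
auxiliary number. -/
inductive Var (p : Params d k) : Type
  | weight (r : Fin p.points)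
  | point (r : Fin p.points) (i : Fin n)
  | mat (i : Fin n)
  | traj (i : Fin n) (l : ℕ)
  | feat (i : Fin n) (l : ℕ)
  | normal (i : Fin n)
  | level (i : Fin n)
  | scalar (i : Fin n)

noncomputable instance : DecidableEq p.Var := Classical.decEq _

/-- The type of the indices of the entries of a variable. -/
abbrev Var.Index {p : Params d k} : Var p → Type
  | weight _ => Unit
  | point _ i => Fin (d i)
  | mat i => Fin (d i) × Fin (k i)
  | traj i _ => Fin (d i)
  | feat i _ => Fin (k i)
  | normal i => Fin (d i)
  | level _ => Unit
  | scalar _ => Unit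

instance (v : p.Var) : DecidableEq v.Index := by cases v <;> exact inferInstance

/-- The real cell in which an entry of a variable is kept. -/
def addr : (v : Var p) → v.Index → ℕ
  | .weight r, _ => (r : ℕ) * p.stride
  | .point r i, c => (r : ℕ) * p.stride + (1 + (Mem.offset d i + c))
  | .mat i, o => p.cell 0 i o.1 o.2
  | .traj i l, c => p.cell 1 i l c
  | .feat i l, j => p.cell 2 i l j
  | .normal i, c => p.cell 3 i 0 c
  | .level i, _ => p.cell 3 i 0 (d i)
  | .scalar i, _ => p.cell 4 i 0 0

theorem cell_inj {a a' : ℕ} {i i' : Fin n} {row row' o o' : ℕ} (ha : a < 5) (ha' : a' < 5)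
    (ho : o < p.Q) (ho' : o' < p.Q) (h : p.cell a i row o = p.cell a' i' row' o') :
    a = a' ∧ i = i' ∧ row = row' ∧ o = o' := by
  obtain ⟨ho, h⟩ := add_mul_inj ho ho' (y := a + 5 * (i + n * row)) (y' := a' + 5 * (i' + n * row'))
    (by simp only [cell] at h; omega)
  obtain ⟨ha, h⟩ := add_mul_inj ha ha' h
  obtain ⟨hi, h⟩ := add_mul_inj i.2 i'.2 h
  exact ⟨ha, Fin.ext hi, h, ho⟩

theorem offset_add_le_offset {i i' : Fin n} (h : i < i') :
    Mem.offset d i + d i ≤ Mem.offset d i' := by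
  rw [Mem.offset, Mem.offset, add_comm, ← Finset.sum_insert (by simp)]
  refine Finset.sum_le_sum_of_subset fun j hj => ?_
  rcases Finset.mem_insert.1 hj with rfl | hj
  exacts [Finset.mem_Iio.2 h, Finset.mem_Iio.2 ((Finset.mem_Iio.1 hj).trans h)]

theorem offset_add_le_sum (i : Fin n) : Mem.offset d i + d i ≤ ∑ j, d j := by
  rw [Mem.offset, add_comm, ← Finset.sum_insert (by simp)]
  exact Finset.sum_le_sum_of_subset (Finset.subset_univ _)

theorem offset_add_inj {i i' : Fin n} {c c' : ℕ} (hc : c < d i) (hc' : c' < d i')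
    (h : Mem.offset d i + c = Mem.offset d i' + c') : i = i' ∧ c = c' := by
  rcases lt_trichotomy i i' with hi | rfl | hi
  · have := offset_add_le_offset (d := d) hi
    omega
  · exact ⟨rfl, by omega⟩
  · have := offset_add_le_offset (d := d) hi
    omega

theorem output_inj {r r' o o' : ℕ} (ho : o < p.stride) (ho' : o' < p.stride)
    (h : r * p.stride + o = r' * p.stride + o') : r = r' ∧ o = o' := by
  rw [add_comm, add_comm _ o', mul_comm, mul_comm r'] at h
  exact (add_mul_inj ho ho' h).symm

theorem output_lt_cell {r o : ℕ} (hr : r < p.points) (ho : o < p.stride) (a : ℕ) (i : Fin n)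
    (row o' : ℕ) : r * p.stride + o < p.cell a i row o' := by
  have : (r + 1) * p.stride ≤ p.points * p.stride := Nat.mul_le_mul_right _ hr
  rw [Nat.add_mul] at this
  simp only [cell]
  omega

theorem stride_pos : 0 < p.stride := by
  simp only [stride]
  omega

theorem offset_lt_stride (i : Fin n) (c : Fin (d i)) : 1 + (Mem.offset d i + c) < p.stride := by
  have := offset_add_le_sum (d := d) i
  simp only [stride]
  omega

theorem addr_inj {v v' : p.Var} {o : v.Index} {o' : v'.Index} (h : p.addr v o = p.addr v' o') :
    (⟨v, o⟩ : Σ v : p.Var, v.Index) = ⟨v', o'⟩ := by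
  have hQ := p.Q_pos
  have hdQ := p.d_lt
  have hd (i : Fin n) (c : Fin (d i)) : (c : ℕ) < p.Q := c.2.trans (p.d_lt i)
  have hk (i : Fin n) (j : Fin (k i)) : (j : ℕ) < p.Q := j.2.trans (p.k_lt i)
  have hweight (r : Fin p.points) := p.output_lt_cell r.2 p.stride_pos
  have hpoint (r : Fin p.points) (i : Fin n) (c : Fin (d i)) :=
    p.output_lt_cell r.2 (p.offset_lt_stride i c)
  rcases v with r | ⟨r, i⟩ | i | ⟨i, l⟩ | ⟨i, l⟩ | i | i | i <;>
    rcases v' with r' | ⟨r', i'⟩ | i' | ⟨i', l'⟩ | ⟨i', l'⟩ | i' | i' | i' <;>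
    simp only [addr] at h
  case weight.weight =>
    obtain rfl := Fin.ext (p.output_inj p.stride_pos p.stride_pos h).1
    rfl
  case weight.point => have := p.output_inj p.stride_pos (p.offset_lt_stride i' o') h; omega
  case point.weight => have := p.output_inj (p.offset_lt_stride i o) p.stride_pos h; omega
  case point.point =>
    obtain ⟨hr, ho⟩ := p.output_inj (p.offset_lt_stride i o) (p.offset_lt_stride i' o') h
    obtain ⟨rfl, ho⟩ := offset_add_inj o.2 o'.2 (Nat.add_left_cancel ho)
    obtain rfl := Fin.ext hr
    obtain rfl := Fin.ext ho
    rfl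
  case mat.mat | traj.traj | feat.feat | normal.normal | normal.level | level.normal |
      level.level | scalar.scalar =>
    obtain ⟨-, rfl, hrow, ho⟩ := p.cell_inj (by norm_num) (by norm_num)
      (by simp only [hd, hk, hdQ, hQ]) (by simp only [hd, hk, hdQ, hQ]) h
    grind
  all_goals
    first
    | exact absurd h (hweight _ _ _ _ _).ne
    | exact absurd h (hweight _ _ _ _ _).ne'
    | exact absurd h (hpoint _ _ _ _ _ _ _).ne
    | exact absurd h (hpoint _ _ _ _ _ _ _).ne'
    | exact absurd (p.cell_inj (by norm_num) (by norm_num)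
        (by simp only [hd, hk, hdQ, hQ]) (by simp only [hd, hk, hdQ, hQ]) h).1 (by norm_num)

/-- The memory `s` holds the sizes `d_i`, `k_i` and `Q` where the address expressions of the
algorithm look them up. -/
structure InMemory (s : Mem) : Prop where
  nat_d : ∀ i : Fin n, s.nat i = d i
  nat_k : ∀ i : Fin n, s.nat (n + i) = k i
  nat_Q : s.nat (2 * n) = p.Q

variable {p} in
theorem InMemory.of_agreeBelow {s s' : Mem} {h : ℕ} (hs : p.InMemory s) (hh : 2 * n < h)
    (hss' : AgreeBelow h s s') : p.InMemory s' where
  nat_d i := (hss' i (by omega)).trans (hs.nat_d i)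
  nat_k i := (hss' (n + i) (by omega)).trans (hs.nat_k i)
  nat_Q := (hss' _ hh).trans hs.nat_Q

end Params

variable {n : ℕ} {d k : Fin n → ℕ} {p : Params d k}

/-- The values of all variables. -/
abbrev Store (p : Params d k) : Type := (v : p.Var) → v.Index → ℝ

namespace Store

/-- The values of all variables in the memory `s`. -/
def ofMem (p : Params d k) (s : Mem) : Store p := fun v o => s.real (p.addr v o)

variable (σ : Store p)

/-- The matrix of player `i`. -/
noncomputable def mat (i : Fin n) : Mat (d i) (k i) := WithLp.toLp 2 (σ (.mat i))

/-- The trajectory of player `i`. -/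
noncomputable def traj (i : Fin n) (l : ℕ) : Vec (d i) := WithLp.toLp 2 (σ (.traj i l))

/-- The vector received by player `i` from the last oracle call. -/
noncomputable def normal (i : Fin n) : Vec (d i) := WithLp.toLp 2 (σ (.normal i))

/-- The profile listed as point number `r` of the output. -/
noncomputable def point (r : Fin p.points) : Profile d := fun i => WithLp.toLp 2 (σ (.point r i))

/-- The entry `o` of `v` changed to `y`. -/
noncomputable def set (v : p.Var) (o : v.Index) (y : ℝ) : Store p :=
  Function.update σ v (Function.update (σ v) o y)

/-- The entries `o` of `v` with `rank o < j` changed to `x o`: an intermediate stage of a loop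
that computes the entries of `v` in the order given by `rank`. -/
noncomputable def fill (v : p.Var) (rank : v.Index → ℕ) (x : v.Index → ℝ) (j : ℕ) : Store p :=
  Function.update σ v fun o => if rank o < j then x o else σ v o

variable {σ}

theorem mat_congr {τ : Store p} {i : Fin n} (h : τ (.mat i) = σ (.mat i)) :
    τ.mat i = σ.mat i := by rw [mat, h, mat]

theorem traj_congr {τ : Store p} {i : Fin n} (h : ∀ l, τ (.traj i l) = σ (.traj i l)) :
    τ.traj i = σ.traj i := funext fun l => by rw [traj, h, traj]

theorem point_congr {τ : Store p} {r : Fin p.points}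
    (h : ∀ i, τ (.point r i) = σ (.point r i)) : τ.point r = σ.point r :=
  funext fun i => by rw [point, h, point]

variable {v : p.Var} {rank : v.Index → ℕ} {x : v.Index → ℝ}

theorem fill_zero : σ.fill v rank x 0 = σ := by simp [fill]

theorem fill_of_forall_lt {j : ℕ} (h : ∀ o, rank o < j) :
    σ.fill v rank x j = Function.update σ v x := by simp [fill, h]

theorem fill_of_ne {v' : p.Var} (h : v' ≠ v) (j : ℕ) : σ.fill v rank x j v' = σ v' :=
  Function.update_of_ne h _ _

theorem fill_rank_apply (o : v.Index) : σ.fill v rank x (rank o) v o = σ v o := by simp [fill]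

theorem set_fill (hrank : Function.Injective rank) (o : v.Index) :
    (σ.fill v rank x (rank o)).set v o (x o) = σ.fill v rank x (rank o + 1) := by
  simp only [set, fill, Function.update_idem, Function.update_self]
  congr 1
  funext o'
  by_cases ho : o' = o
  · simp [ho]
  · rw [Function.update_of_ne ho]
    exact if_congr (by have := hrank.ne ho; omega) rfl rfl

theorem set_set {o : v.Index} {y z : ℝ} : (σ.set v o y).set v o z = σ.set v o z := by
  simp [set]

theorem set_of_ne {o : v.Index} {y : ℝ} {v' : p.Var} (h : v' ≠ v) : σ.set v o y v' = σ v' :=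
  Function.update_of_ne h _ _

theorem set_apply_self {o : v.Index} {y : ℝ} : σ.set v o y v o = y := by simp [set]

/-- The variables of the memory `s` have the values `σ`. -/
structure IsStored (σ : Store p) (s : Mem) : Prop extends p.InMemory s where
  real_addr : ∀ v o, s.real (p.addr v o) = σ v o

end Store

theorem Store.isStored_ofMem {s : Mem} (hs : p.InMemory s) : (Store.ofMem p s).IsStored s :=
  ⟨hs, fun _ _ => rfl⟩

theorem Store.IsStored.ofMem_eq {σ : Store p} {s : Mem} (hs : σ.IsStored s) : ofMem p s = σ :=
  funext fun v => funext fun o => hs.real_addr v o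

/-- Some part of the program leads from `s` to `s'`, where the variables have the values `σ'`; it
uses natural-number cells from `h` on. -/
structure Evolves (h : ℕ) (s : Mem) (σ' : Store p) (s' : Mem) : Prop where
  stored : σ'.IsStored s'
  agree : AgreeBelow h s s'

namespace Store.IsStored

variable {σ : Store p} {s s' : Mem}

theorem evolves (hs : σ.IsStored s) (h : ℕ) : Evolves h s σ s := ⟨hs, .refl h s⟩

theorem setNat (hs : σ.IsStored s) {a x : ℕ} (ha : 2 * n < a) : σ.IsStored (s.setNat a x) where
  toInMemory := hs.toInMemory.of_agreeBelow (h := a) ha ((AgreeBelow.refl a s).setNat le_rfl)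
  real_addr := hs.real_addr

theorem update (hs : σ.IsStored s) (hnat : s'.nat = s.nat) {v : p.Var} {x : v.Index → ℝ}
    (hv : ∀ o, s'.real (p.addr v o) = x o)
    (hne : ∀ a, (∀ o, a ≠ p.addr v o) → s'.real a = s.real a) :
    Store.IsStored (Function.update σ v x) s' where
  toInMemory := hs.toInMemory.of_agreeBelow (h := 2 * n + 1) (by omega) fun a _ => congrFun hnat a
  real_addr v' o' := by
    by_cases hv' : v' = v
    · subst hv'
      rw [Function.update_self, hv]
    · rw [Function.update_of_ne hv', hne, hs.real_addr]
      exact fun o h => hv' (congrArg Sigma.fst (p.addr_inj h))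

theorem setReal (hs : σ.IsStored s) (v : p.Var) (o : v.Index) (y : ℝ) :
    (σ.set v o y).IsStored (s.setReal (p.addr v o) y) := by
  refine hs.update (s' := s.setReal (p.addr v o) y) rfl (fun o' => ?_) fun a ha => by simp [ha o]
  by_cases ho : o' = o
  · simp [ho]
  · have : p.addr v o' ≠ p.addr v o := fun h => ho (by simpa using p.addr_inj h)
    simp [ho, this, hs.real_addr]

theorem writeVec (hs : σ.IsStored s) {v : p.Var} {b a : ℕ} (idx : Fin b ≃ v.Index)
    (ha : ∀ c : Fin b, p.addr v (idx c) = a + c) (x : Fin b → ℝ) :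
    Store.IsStored (Function.update σ v fun o => x (idx.symm o)) (s.writeVec a x) := by
  refine hs.update (s' := s.writeVec a x) rfl (fun o => ?_) fun a' ha' =>
    Mem.writeVec_real_of_notMem _ _ _ fun h => ?_
  · rw [← idx.apply_symm_apply o, ha, Mem.writeVec_real_add, idx.symm_apply_apply]
  · refine ha' (idx ⟨a' - a, by omega⟩) ?_
    rw [ha]
    exact (Nat.add_sub_of_le h.1).symm

theorem readVec_traj (hs : σ.IsStored s) (i : Fin n) (l : ℕ) :
    s.readVec (d i) (p.cell 1 i l 0) = σ.traj i l := by
  ext c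
  refine Eq.trans ?_ (hs.real_addr (.traj i l) c)
  simp only [Params.addr, Params.cell, Mem.readVec, add_zero, add_assoc]

theorem readProfile_point (hs : σ.IsStored s) (r : Fin p.points) :
    s.readProfile d (r * p.stride + 1) = σ.point r := by
  ext i c
  refine Eq.trans ?_ (hs.real_addr (.point r i) c)
  simp only [Params.addr, Mem.readProfile, Mem.readVec, add_assoc]

end Store.IsStored

/-! ### Programs acting on variables -/

namespace NExp

variable {n : ℕ}

/-- The number `Q`. -/
def size (n : ℕ) : NExp := var (2 * n)

/-- The number `Params.stride`. -/
def stride (n : ℕ) : NExp := const 1 + sum fun i : Fin n => var i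

/-- The address of the probability of point `r`. -/
def weight (n : ℕ) (r : NExp) : NExp := r * stride n

/-- The address of point `r`. -/
def profile (n : ℕ) (r : NExp) : NExp := r * stride n + const 1

/-- The address of entry `c` of player `i`'s strategy in point `r`. -/
def point (r : NExp) (i : Fin n) (c : NExp) : NExp :=
  r * stride n + (const 1 + (sum (fun j : Fin n => if j < i then var j else const 0) + c))

/-- The address `Params.cell`. -/
def cell (a : ℕ) (i : Fin n) (row o : NExp) : NExp :=
  pow (size n) (n + 7) * stride n + const 3 +
    (size n * (const a + const 5 * (const i + const n * row)) + o)

/-- The address of entry `(c, j)` of player `i`'s matrix. -/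
def mat (i : Fin n) (c j : NExp) : NExp := cell 0 i c j

/-- The address of entry `c` of point `l` of player `i`'s trajectory. -/
def traj (i : Fin n) (l c : NExp) : NExp := cell 1 i l c

/-- The address of entry `j` of the features of point `l` of player `i`'s trajectory. -/
def feat (i : Fin n) (l j : NExp) : NExp := cell 2 i l j

/-- The address of entry `c` of the last vector received by player `i` from an oracle. -/
def normal (i : Fin n) (c : NExp) : NExp := cell 3 i (const 0) c

/-- The address of the number that goes with `normal i`. -/
def level (i : Fin n) : NExp := cell 3 i (const 0) (var i)

/-- The address of player `i`'s auxiliary number. -/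
def scalar (i : Fin n) : NExp := cell 4 i (const 0) (const 0)

end NExp

variable {n : ℕ} {d k : Fin n → ℕ} {p : Params d k} {s : Mem}

namespace Params.InMemory

variable {r l o o' : NExp} {i : Fin n} (hs : p.InMemory s)

include hs

theorem eval_size : (NExp.size n).eval s = p.Q := hs.nat_Q

theorem eval_stride : (NExp.stride n).eval s = p.stride := by
  simp [NExp.stride, Params.stride, hs.nat_d]

theorem eval_weight {R : Fin p.points} (hr : r.eval s = R) :
    (NExp.weight n r).eval s = p.addr (.weight R) () := by
  simp [NExp.weight, Params.addr, hs.eval_stride, hr]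

theorem eval_profile : (NExp.profile n r).eval s = r.eval s * p.stride + 1 := by
  simp [NExp.profile, hs.eval_stride]

theorem eval_point {R : Fin p.points} {c : Fin (d i)} (hr : r.eval s = R) (hc : o.eval s = c) :
    (NExp.point r i o).eval s = p.addr (.point R i) c := by
  have hoffset : ∑ j : Fin n, (if j < i then NExp.var j else .const 0).eval s = Mem.offset d i := by
    rw [Mem.offset, ← Finset.filter_gt_eq_Iio, Finset.sum_filter]
    refine Finset.sum_congr rfl fun j _ => ?_
    split_ifs <;> simp [hs.nat_d]
  simp [NExp.point, Params.addr, hs.eval_stride, hr, hc, hoffset]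

theorem eval_cell (a : ℕ) : (NExp.cell a i l o).eval s = p.cell a i (l.eval s) (o.eval s) := by
  simp [NExp.cell, Params.cell, hs.eval_stride, hs.eval_size, Params.points]

theorem eval_mat {c : Fin (d i)} {j : Fin (k i)} (hc : o.eval s = c) (hj : o'.eval s = j) :
    (NExp.mat i o o').eval s = p.addr (.mat i) (c, j) := by
  rw [NExp.mat, hs.eval_cell, hc, hj, Params.addr]

theorem eval_traj {L : ℕ} {c : Fin (d i)} (hl : l.eval s = L) (hc : o.eval s = c) :
    (NExp.traj i l o).eval s = p.addr (.traj i L) c := by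
  rw [NExp.traj, hs.eval_cell, hl, hc, Params.addr]

theorem eval_feat {L : ℕ} {j : Fin (k i)} (hl : l.eval s = L) (hj : o.eval s = j) :
    (NExp.feat i l o).eval s = p.addr (.feat i L) j := by
  rw [NExp.feat, hs.eval_cell, hl, hj, Params.addr]

theorem eval_normal {c : Fin (d i)} (hc : o.eval s = c) :
    (NExp.normal i o).eval s = p.addr (.normal i) c := by
  rw [NExp.normal, hs.eval_cell, hc, Params.addr, NExp.eval_const]

theorem eval_level : (NExp.level i).eval s = p.addr (.level i) () := by
  rw [NExp.level, hs.eval_cell, NExp.eval_var, hs.nat_d, Params.addr, NExp.eval_const]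

theorem eval_scalar : (NExp.scalar i).eval s = p.addr (.scalar i) () := by
  rw [NExp.scalar, hs.eval_cell, Params.addr, NExp.eval_const]

end Params.InMemory

theorem Store.IsStored.eval_mem {σ : Store p} (hs : σ.IsStored s) {a : NExp} {v : p.Var}
    {o : v.Index} (ha : a.eval s = p.addr v o) : (RExp.mem a).eval s = σ v o := by
  rw [RExp.eval_mem, ha, hs.real_addr]

namespace Runs

variable {O : Oracles d k} {σ : Store p}

theorem store_rset (hs : σ.IsStored s) {a : NExp} {e : RExp} {v : p.Var} {o : v.Index} (h : ℕ)
    (ha : a.eval s = p.addr v o) {y : ℝ} (he : e.eval s = y) :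
    Runs O p.Q (.rset a e) s (a.cost + e.cost + 1 : ℕ) (Evolves h s (σ.set v o y)) := by
  refine Runs.rset ⟨?_, fun _ _ => rfl⟩
  rw [ha, he]
  exact hs.setReal v o y

theorem store_forN {h B : ℕ} {e : NExp} {P : Prog n} {f : ℕ[X]} (S : ℕ → Store p)
    (hs : (S 0).IsStored s) (hh : 2 * n < h) (he : ∀ s', p.InMemory s' → e.eval s' = B)
    (hB : B ≤ p.Q)
    (hP : ∀ j < B, ∀ s', (S j).IsStored s' → AgreeBelow h s s' → (NExp.var h).eval s' = j →
      Runs O p.Q P s' f (Evolves (h + 1) s' (S (j + 1)))) :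
    Runs O p.Q (Prog.forN h e P) s (forBound h e f X) (Evolves h s (S B)) := by
  refine Runs.forN (fun j => Evolves h s (S j)) ⟨hs.setNat hh, (AgreeBelow.refl h s).setNat le_rfl⟩
    (by simpa using hB) (fun j s' hs' => he s' hs'.stored.toInMemory) fun j hj s' hs' hv => ?_
  exact (hP j hj s' hs'.stored hs'.agree hv).mono fun s'' hs'' =>
    ⟨(hs''.agree h (by omega)).trans hv, hs''.stored.setNat hh,
      (hs'.agree.trans (hs''.agree.mono (by omega))).setNat le_rfl⟩

end Runs

/-- The program that stores `∑ j < e, t` at the address `a`, where the term `t` depends on the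
counter `h`. -/
def Prog.sumInto (h : ℕ) (e a : NExp) (t : RExp) : Prog n :=
  .seq (.rset a (.ofNat (.const 0))) (Prog.forN h e (.rset a (.mem a + t)))

namespace Runs

variable {O : Oracles d k} {σ : Store p}

/-- The running time of `Prog.sumInto`. -/
noncomputable def sumBound (h : ℕ) (e a : NExp) (t : RExp) : ℕ[X] :=
  (a.cost + (RExp.ofNat (.const 0)).cost + 1 : ℕ) +
    forBound h e (a.cost + (RExp.mem a + t).cost + 1 : ℕ) X

theorem sumInto {h B : ℕ} {e a : NExp} {t : RExp} {v : p.Var} {o : v.Index} {T : Fin B → ℝ}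
    (hs : σ.IsStored s) (hh : 2 * n < h) (he : ∀ s', p.InMemory s' → e.eval s' = B) (hB : B ≤ p.Q)
    (ha : ∀ s', p.InMemory s' → AgreeBelow h s s' → a.eval s' = p.addr v o)
    (ht : ∀ (j : Fin B) s' y, (σ.set v o y).IsStored s' → AgreeBelow h s s' →
      (NExp.var h).eval s' = j → t.eval s' = T j) :
    Runs O p.Q (Prog.sumInto h e a t) s (sumBound h e a t)
      (Evolves h s (σ.set v o (∑ j, T j))) := by
  let S (j : ℕ) : ℝ := ∑ l ∈ Finset.range j, if hl : l < B then T ⟨l, hl⟩ else 0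
  refine Runs.seq (Runs.store_rset hs h (ha s hs.toInMemory (.refl h s)) (y := S 0)
    (by simp [S])) fun s₁ hs₁ => ?_
  refine (Runs.store_forN (fun j => σ.set v o (S j)) hs₁.stored hh he hB
    fun j hj s₂ hs₂ hss₂ hv => ?_).mono fun s' hs' =>
      ⟨by simpa [S, Finset.sum_range] using hs'.stored, hs₁.agree.trans hs'.agree⟩
  have hss₂' := hs₁.agree.trans hss₂
  have hterm := ht ⟨j, hj⟩ s₂ _ hs₂ hss₂' hv
  have hS : S (j + 1) = S j + T ⟨j, hj⟩ := by simp only [S, Finset.sum_range_succ, dif_pos hj]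
  have haddr := ha s₂ hs₂.toInMemory hss₂'
  have := Runs.store_rset (O := O) hs₂ (h + 1) haddr (e := .mem a + t) (y := S (j + 1))
    (by rw [RExp.eval_add, hs₂.eval_mem haddr, hterm, hS, Store.set_apply_self])
  rwa [Store.set_set] at this

end Runs

/-! ### Linear algebra -/

/-- The expression `e` has the value `x` in `s`, and keeps it as long as only natural-number cells
from `h` on are overwritten. -/
def NExp.Keeps (h : ℕ) (s : Mem) (e : NExp) (x : ℕ) : Prop :=
  ∀ s', AgreeBelow h s s' → e.eval s' = x

theorem NExp.keeps_var {h a x : ℕ} {s : Mem} (ha : a < h) (hx : s.nat a = x) :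
    (var a).Keeps h s x := fun _ hs' => (hs' a ha).trans hx

theorem NExp.Keeps.succ {h x : ℕ} {s : Mem} {e : NExp} (he : e.Keeps h s x) :
    (e + const 1).Keeps h s (x + 1) := fun s' hs' => by simp [he s' hs']

namespace Prog

variable {n : ℕ}

-- Natural-number cells: `2n + 1` counts rounds, `2n + 2` counts the points listed so far,
-- `2n + 3 + i` holds the current time of player `i`, `3n + 3` the position in the trajectory under
-- construction, `3n + 4` the flag of the separation oracle; the linear algebra uses `3n + 5` and
-- `3n + 6`.

/-- Let entry `i` of point `r` be point `l` of player `i`'s trajectory. -/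
def copy (i : Fin n) (l r : NExp) : Prog n :=
  forN (3 * n + 5) (.var i)
    (.rset (.point r i (.var (3 * n + 5))) (.mem (.traj i l (.var (3 * n + 5)))))

/-- Continue player `i`'s trajectory from point `l` by applying her matrix to the features. -/
def mulVec (i : Fin n) (l : NExp) : Prog n :=
  forN (3 * n + 5) (.var i)
    (sumInto (3 * n + 6) (.var (n + i)) (.traj i (l + .const 1) (.var (3 * n + 5)))
      (.mem (.mat i (.var (3 * n + 5)) (.var (3 * n + 6))) *
        .mem (.feat i l (.var (3 * n + 6)))))

/-- Compute the squared norm of `normal i` in `scalar i`. -/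
def normSq (i : Fin n) : Prog n :=
  sumInto (3 * n + 5) (.var i) (.scalar i)
    (.mem (.normal i (.var (3 * n + 5))) * .mem (.normal i (.var (3 * n + 5))))

/-- Add to player `i`'s matrix `scalar i` times the rank-one matrix made from `normal i` and the
features of point `l`. -/
def addOuter (i : Fin n) (l : NExp) : Prog n :=
  forN (3 * n + 5) (.var i) (forN (3 * n + 6) (.var (n + i))
    (.rset (.mat i (.var (3 * n + 5)) (.var (3 * n + 6)))
      (.mem (.mat i (.var (3 * n + 5)) (.var (3 * n + 6))) +
        .mem (.scalar i) * (.mem (.normal i (.var (3 * n + 5))) *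
          .mem (.feat i l (.var (3 * n + 6)))))))

end Prog

namespace Runs

variable {n : ℕ} {d k : Fin n → ℕ} {p : Params d k} {s : Mem} {O : Oracles d k} {σ : Store p}

theorem store_forN_entries {h B : ℕ} {e : NExp} {P : Prog n} {f : ℕ[X]} {v : p.Var}
    (idx : v.Index ≃ Fin B) (x : v.Index → ℝ) (hs : σ.IsStored s) (hh : 2 * n < h)
    (he : ∀ s', p.InMemory s' → e.eval s' = B) (hB : B ≤ p.Q)
    (hP : ∀ (τ : Store p) o s', τ.IsStored s' → AgreeBelow h s s' → (∀ v' ≠ v, τ v' = σ v') →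
      (NExp.var h).eval s' = idx o → Runs O p.Q P s' f (Evolves (h + 1) s' (τ.set v o (x o)))) :
    Runs O p.Q (Prog.forN h e P) s (forBound h e f X)
      (Evolves h s (Function.update σ v x)) := by
  rw [← Store.fill_of_forall_lt (rank := (idx ·)) fun o => (idx o).2]
  refine store_forN (σ.fill v (idx ·) x) (by rwa [Store.fill_zero]) hh he hB
    fun j hj s' hs' hss' hv => ?_
  obtain ⟨o, ho⟩ := idx.surjective ⟨j, hj⟩
  obtain rfl : (idx o : ℕ) = j := congrArg Fin.val ho
  rw [← Store.set_fill (rank := (idx ·)) (Fin.val_injective.comp idx.injective)]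
  exact hP _ o s' hs' hss' (fun _ hne => Store.fill_of_ne hne _) hv

theorem store_forN_pairs {a b h : ℕ} {e e' : NExp} {P : Prog n} {f : ℕ[X]} {v : p.Var}
    (idx : v.Index ≃ Fin a × Fin b) (x : v.Index → ℝ) (hs : σ.IsStored s) (hh : 2 * n < h)
    (he : ∀ s', p.InMemory s' → e.eval s' = a) (ha : a ≤ p.Q)
    (he' : ∀ s', p.InMemory s' → e'.eval s' = b) (hb : b ≤ p.Q)
    (hP : ∀ (τ : Store p) o s', τ.IsStored s' → AgreeBelow h s s' → (∀ v' ≠ v, τ v' = σ v') →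
      τ v o = σ v o → (NExp.var h).eval s' = (idx o).1 → (NExp.var (h + 1)).eval s' = (idx o).2 →
        Runs O p.Q P s' f (Evolves (h + 2) s' (τ.set v o (x o)))) :
    Runs O p.Q (Prog.forN h e (Prog.forN (h + 1) e' P)) s
      (forBound h e (forBound (h + 1) e' f X) X) (Evolves h s (Function.update σ v x)) := by
  let rank (o : v.Index) : ℕ := finProdFinEquiv (idx o)
  have hrank : Function.Injective rank :=
    Fin.val_injective.comp (finProdFinEquiv.injective.comp idx.injective)
  rw [← Store.fill_of_forall_lt (rank := rank) (j := b * a)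
    fun o => (finProdFinEquiv (idx o)).2.trans_eq (mul_comm a b)]
  refine store_forN (fun c => σ.fill v rank x (b * c)) (by simpa [Store.fill_zero] using hs) hh he
    ha fun c hc s₁ hs₁ hss₁ hv₁ => ?_
  rw [Nat.mul_succ]
  refine store_forN (fun j => σ.fill v rank x (b * c + j)) hs₁ (by omega) he' hb
    fun j hj s₂ hs₂ hss₂ hv₂ => ?_
  obtain ⟨o, ho⟩ := idx.surjective (⟨c, hc⟩, ⟨j, hj⟩)
  have hjo : rank o = b * c + j := by simp [rank, ho, finProdFinEquiv, add_comm]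
  rw [← add_assoc, ← hjo, ← Store.set_fill hrank]
  rw [← hjo] at hs₂
  refine hP _ o s₂ hs₂ (hss₁.trans (hss₂.mono (by omega))) (fun _ hne => Store.fill_of_ne hne _)
    (Store.fill_rank_apply o) ?_ (by rw [hv₂, ho])
  rw [NExp.eval_var, hss₂ h (by omega), ← NExp.eval_var, hv₁, ho]

end Runs

theorem exists_runs_copy {n : ℕ} (i : Fin n) (l r : NExp) : ∃ f : ℕ[X],
    ∀ {d k : Fin n → ℕ} {p : Params d k} {O : Oracles d k} {s : Mem} {σ : Store p} {L : ℕ}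
      {R : Fin p.points}, σ.IsStored s → l.Keeps (3 * n + 5) s L → r.Keeps (3 * n + 5) s R →
      Runs O p.Q (Prog.copy i l r) s f
        (Evolves (3 * n + 5) s (Function.update σ (.point R i) (σ.traj i L))) := by
  refine ⟨_, fun {d _ p _ s σ L R} hs hl hr =>
    Runs.store_forN_entries (v := .point R i) (Equiv.refl (Fin (d i))) (σ (.traj i L)) hs (by omega)
      (fun s' hs' => hs'.nat_d i) (p.d_lt i).le fun τ o s' hs' hss' hτ hv =>
        Runs.store_rset hs' _ ?_ ?_⟩
  · exact hs'.eval_point (hr s' hss') hv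
  · have hv : (NExp.var (3 * n + 5)).eval s' = Fin.val (n := d i) o := hv
    rw [hs'.eval_mem (hs'.eval_traj (hl s' hss') hv), hτ _ (by simp)]

theorem exists_runs_mulVec {n : ℕ} (i : Fin n) (l : NExp) : ∃ f : ℕ[X],
    ∀ {d k : Fin n → ℕ} {p : Params d k} {O : Oracles d k} {s : Mem} {σ : Store p} {L : ℕ},
      σ.IsStored s → l.Keeps (3 * n + 5) s L →
      Runs O p.Q (Prog.mulVec i l) s f (Evolves (3 * n + 5) s
        (Function.update σ (.traj i (L + 1)) (app (σ.mat i) (σ (.feat i L))))) := by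
  refine ⟨_, fun {d _ p _ s σ L} hs hl =>
    Runs.store_forN_entries (v := .traj i (L + 1)) (Equiv.refl (Fin (d i)))
      (app (σ.mat i) (σ (.feat i L))) hs (by omega) (fun s' hs' => hs'.nat_d i) (p.d_lt i).le
      fun τ o s' hs' hss' hτ hv => Runs.sumInto
        (T := fun j => σ (.mat i) (o, j) * σ (.feat i L) j) hs' (by omega)
        (fun _ h => h.nat_k i) (p.k_lt i).le (fun s₁ hs₁ hss₁ => ?_)
        fun j s₁ y hs₁ hss₁ hv₁ => ?_⟩ <;>
  have ho : (NExp.var (3 * n + 5)).eval s₁ = Fin.val (n := d i) o :=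
    (hss₁ (3 * n + 5) (by omega)).trans hv <;>
  have hL := hss'.trans (hss₁.mono (by omega))
  · exact hs₁.eval_traj (hl.succ s₁ hL) ho
  · rw [RExp.eval_mul, hs₁.eval_mem (hs₁.eval_mat ho hv₁),
      hs₁.eval_mem (hs₁.eval_feat (hl s₁ hL) hv₁), Store.set_of_ne (by simp),
      Store.set_of_ne (by simp), hτ _ (by simp), hτ _ (by simp)]

theorem exists_runs_normSq {n : ℕ} (i : Fin n) : ∃ f : ℕ[X],
    ∀ {d k : Fin n → ℕ} {p : Params d k} {O : Oracles d k} {s : Mem} {σ : Store p},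
      σ.IsStored s → Runs O p.Q (Prog.normSq i) s f
        (Evolves (3 * n + 5) s (σ.set (.scalar i) () (∑ c, σ.normal i c ^ 2))) := by
  refine ⟨_, fun {d _ p _ s σ} hs => Runs.sumInto (T := (σ.normal i · ^ 2)) hs (by omega)
    (fun _ h => h.nat_d i) (p.d_lt i).le (fun _ h _ => h.eval_scalar) fun c s' y hs' _ hv => ?_⟩
  rw [RExp.eval_mul, hs'.eval_mem (hs'.eval_normal hv), Store.set_of_ne (by simp), pow_two]
  rfl

theorem exists_runs_addOuter {n : ℕ} (i : Fin n) (l : NExp) : ∃ f : ℕ[X],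
    ∀ {d k : Fin n → ℕ} {p : Params d k} {O : Oracles d k} {s : Mem} {σ : Store p} {L : ℕ},
      σ.IsStored s → l.Keeps (3 * n + 5) s L →
      Runs O p.Q (Prog.addOuter i l) s f (Evolves (3 * n + 5) s (Function.update σ (.mat i)
        (σ.mat i + σ (.scalar i) () • outer (σ.normal i) (σ (.feat i L)) : Mat _ _))) := by
  refine ⟨_, fun {d k p O s σ L} hs hl =>
    Runs.store_forN_pairs (v := .mat i) (Equiv.refl (Fin (d i) × Fin (k i))) _ hs (by omega)
      (fun _ h => h.nat_d i) (p.d_lt i).le (fun _ h => h.nat_k i) (p.k_lt i).le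
      fun τ o s' hs' hss' hτ ho hc hj => Runs.store_rset hs' _ ?_ ?_⟩
  · exact hs'.eval_mat hc hj
  have hc : (NExp.var (3 * n + 5)).eval s' = Fin.val (n := d i) o.1 := hc
  have hj : (NExp.var (3 * n + 6)).eval s' = Fin.val (n := k i) o.2 := hj
  rw [RExp.eval_add, RExp.eval_mul, RExp.eval_mul, hs'.eval_mem (hs'.eval_mat hc hj), ho,
    hs'.eval_mem hs'.eval_scalar, hs'.eval_mem (hs'.eval_normal hc),
    hs'.eval_mem (hs'.eval_feat (hl s' hss') hj), hτ _ (by simp), hτ _ (by simp), hτ _ (by simp)]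
  rfl

/-! ### Oracle calls -/

namespace Prog

variable {n : ℕ}

/-- Query the features of point `l` of player `i`'s trajectory. -/
def queryFeat (i : Fin n) (l : NExp) : Prog n :=
  .feat i (.traj i l (.const 0)) (.feat i l (.const 0))

/-- Query player `i`'s supergradient at point `r` and store it in `normal i`. -/
def queryGrad (i : Fin n) (r : NExp) : Prog n :=
  .grad i (.profile n r) (.normal i (.const 0))

/-- Separate point `l` of player `i`'s trajectory from her strategy set, storing the hyperplane in
`normal i` and `level i`. -/
def querySep (i : Fin n) (l : NExp) : Prog n :=
  .sep i (.traj i l (.const 0)) (.normal i (.const 0)) (.const (3 * n + 4))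

end Prog

section OracleCalls

variable {n : ℕ} (i : Fin n)

theorem Store.IsStored.writeVec_normal {d k : Fin n → ℕ} {p : Params d k} {σ : Store p} {s : Mem}
    (hs : σ.IsStored s) (a : Vec (d i)) :
    Store.IsStored (Function.update σ (.normal i) a) (s.writeVec (p.cell 3 i 0 0) a) :=
  hs.writeVec (v := .normal i) (Equiv.refl (Fin (d i)))
    (fun c => by simp [Params.addr, Params.cell, add_assoc]) a

theorem exists_runs_queryFeat (l : NExp) : ∃ f : ℕ[X],
    ∀ {d k : Fin n → ℕ} {p : Params d k} {O : Oracles d k} {s : Mem} {σ : Store p} {L : ℕ} (h : ℕ),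
      σ.IsStored s → l.eval s = L → Runs O p.Q (Prog.queryFeat i l) s f
        (Evolves h s (Function.update σ (.feat i L) (O.feat i (σ.traj i L)))) := by
  refine ⟨_, fun {d k p O s σ L} h hs hl => Runs.of_exec
    (c := (NExp.traj i l (.const 0)).cost + (NExp.feat i l (.const 0)).cost + 1)
    (.feat s i _ _) (by have := p.d_lt i; have := p.k_lt i; omega) ⟨?_, fun _ _ => rfl⟩⟩
  rw [NExp.traj, NExp.feat, hs.eval_cell, hs.eval_cell, hl, NExp.eval_const, hs.readVec_traj]
  exact hs.writeVec (v := .feat i L) (Equiv.refl (Fin (k i)))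
    (fun c => by simp [Params.addr, Params.cell, add_assoc]) _

theorem exists_runs_queryGrad (r : NExp) : ∃ f : ℕ[X],
    ∀ {d k : Fin n → ℕ} {p : Params d k} {O : Oracles d k} {s : Mem} {σ : Store p}
      {R : Fin p.points} (h : ℕ), σ.IsStored s → r.eval s = R →
      Runs O p.Q (Prog.queryGrad i r) s f
        (Evolves h s (Function.update σ (.normal i) (O.grad i (σ.point R)))) := by
  refine ⟨_, fun {d k p O s σ R} h hs hr => Runs.of_exec
    (c := (NExp.profile n r).cost + (NExp.normal i (.const 0)).cost + 1)
    (.grad s i _ _) (by have := p.d_lt i; have := p.sum_d_lt; omega) ⟨?_, fun _ _ => rfl⟩⟩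
  rw [hs.eval_profile, hr, hs.readProfile_point, NExp.normal, hs.eval_cell]
  exact hs.writeVec_normal i _

theorem exists_runs_querySep (l : NExp) : ∃ f : ℕ[X],
    ∀ {Γ : ConcaveGame n} {k : Fin n → ℕ} {p : Params Γ.d k} {O : Oracles Γ.d k}
      {m : (i : Fin n) → Vec (Γ.d i) → Fin (k i) → ℝ} {s : Mem} {σ : Store p} {L : ℕ},
      O.Correct Γ m → σ.IsStored s → l.eval s = L → Runs O p.Q (Prog.querySep i l) s f fun s' =>
        (σ.traj i L ∈ Γ.X i ∧ s'.nat (3 * n + 4) = 1 ∧ Evolves (3 * n + 4) s σ s') ∨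
        ∃ a b, b < inner ℝ a (σ.traj i L) ∧ (∀ z ∈ Γ.X i, inner ℝ a z ≤ b) ∧
          s'.nat (3 * n + 4) = 0 ∧ Evolves (3 * n + 4) s
            (Store.set (Function.update σ (.normal i) a) (.level i) () b) s' := by
  refine ⟨_, fun {Γ k p O m s σ L} hO hs hl => Runs.of_exec
    (c := (NExp.traj i l (.const 0)).cost + (NExp.normal i (.const 0)).cost +
      (NExp.const (3 * n + 4)).cost + 2)
    (.sep s i _ _ _) (by have := p.d_lt i; omega) ?_⟩
  rw [NExp.traj, NExp.normal, hs.eval_cell, hs.eval_cell, hl, NExp.eval_const, NExp.eval_const,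
    hs.readVec_traj]
  have hagree (x : ℕ) : AgreeBelow (3 * n + 4) s (s.setNat (3 * n + 4) x) :=
    (AgreeBelow.refl _ s).setNat le_rfl
  by_cases hmem : σ.traj i L ∈ Γ.X i
  · rw [hO.sep_mem i _ hmem]
    exact Or.inl ⟨hmem, by simp [Mem.writeSep], hs.setNat (by omega), hagree 1⟩
  · obtain ⟨a, b, hsep, hb, hab⟩ := hO.sep_not_mem i _ hmem
    rw [hsep]
    refine Or.inr ⟨a, b, hb, hab, by simp [Mem.writeSep], ?_, hagree 0⟩
    have haddr : p.cell 3 i 0 0 + Γ.d i = p.addr (.level i) () := by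
      simp [Params.addr, Params.cell, add_assoc]
    rw [Mem.writeSep, haddr]
    exact ((hs.setNat (by omega)).writeVec_normal i a).setReal (.level i) () b

end OracleCalls

/-! ### Computing trajectories -/

/-- The size parameter dominates the radii of the strategy sets and the bounds on the features. -/
structure Params.Dominates {n : ℕ} {Γ : ConcaveGame n} {k : Fin n → ℕ} (p : Params Γ.d k)
    (m : (i : Fin n) → Vec (Γ.d i) → Fin (k i) → ℝ) : Prop where
  closedBall_subset : ∀ i, Metric.closedBall 0 1 ⊆ Γ.X i
  subset_closedBall : ∀ i, Γ.X i ⊆ Metric.closedBall 0 p.Q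
  featureBound : ∀ i, FeatureBound (Γ.X i) (m i) p.Q

theorem Params.one_le_Q {n : ℕ} {d k : Fin n → ℕ} (p : Params d k) : (1 : ℝ) ≤ p.Q := by
  exact_mod_cast p.Q_pos

namespace Params.Dominates

variable {n : ℕ} {Γ : ConcaveGame n} {k : Fin n → ℕ} {p : Params Γ.d k}
  {m : (i : Fin n) → Vec (Γ.d i) → Fin (k i) → ℝ} (hp : p.Dominates m)

include hp

theorem zero_mem (i : Fin n) : (0 : Vec (Γ.d i)) ∈ Γ.X i := hp.closedBall_subset i (by simp)

theorem norm_le {i : Fin n} {x : Vec (Γ.d i)} (hx : x ∈ Γ.X i) : ‖x‖ ≤ p.Q := by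
  simpa using hp.subset_closedBall i hx

theorem sum_sq_le (i : Fin n) (x : Vec (Γ.d i)) (hx : x ∈ Γ.X i) :
    ∑ j, m i x j ^ 2 ≤ (p.Q : ℝ) ^ 3 := by
  have hk : (k i : ℝ) ≤ p.Q := by exact_mod_cast (p.k_lt i).le
  calc ∑ j, m i x j ^ 2 ≤ ∑ _j : Fin (k i), (p.Q : ℝ) ^ 2 := Finset.sum_le_sum fun j _ =>
        sq_le_sq.2 (((hp.featureBound i).1 x hx j).trans (le_abs_self _))
    _ = k i * (p.Q : ℝ) ^ 2 := by simp
    _ ≤ p.Q * (p.Q : ℝ) ^ 2 := by gcongr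
    _ = (p.Q : ℝ) ^ 3 := by ring

end Params.Dominates

/-- The player who owns a variable; the output belongs to nobody. -/
def Params.Var.owner {n : ℕ} {d k : Fin n → ℕ} {p : Params d k} : p.Var → Option (Fin n)
  | .weight _ | .point _ _ => none
  | .mat i | .traj i _ | .feat i _ | .normal i | .level i | .scalar i => some i

/-- Between `σ` and `σ'`, player `i`'s matrix has been corrected so that, as far as is known, the
first `l` steps of her trajectory stay inside her strategy set. -/
structure Settled {n : ℕ} {Γ : ConcaveGame n} {k : Fin n → ℕ} {p : Params Γ.d k}
    (m : (i : Fin n) → Vec (Γ.d i) → Fin (k i) → ℝ) (i : Fin n) (σ σ' : Store p) (l : ℕ) :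
    Prop where
  start : σ'.traj i 0 = 0
  isTrajectory : IsTrajectory (Γ.X i) (m i) (σ'.mat i) (σ'.traj i) l
  feat : ∀ l' < l, σ' (.feat i l') = m i (σ'.traj i l')
  norm_le : ∀ K' : Mat (Γ.d i) (k i), (∀ y ∈ Γ.X i, app K' (m i y) ∈ Γ.X i) →
    ‖σ'.mat i - (1 - 1 / (p.Q : ℝ)) • K'‖ ^ 2 ≤ ‖σ.mat i - (1 - 1 / (p.Q : ℝ)) • K'‖ ^ 2

/-- A search by player `i` has led from `σ` to `σ'`, and changed only her own variables. -/
structure Search {n : ℕ} {Γ : ConcaveGame n} {k : Fin n → ℕ} {p : Params Γ.d k}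
    (m : (i : Fin n) → Vec (Γ.d i) → Fin (k i) → ℝ) (i : Fin n) (σ σ' : Store p) (l : ℕ) : Prop
    extends Settled m i σ σ' l where
  eq_of_owner_ne : ∀ v : p.Var, v.owner ≠ some i → σ' v = σ v

namespace Store

variable {n : ℕ} {d k : Fin n → ℕ} {p : Params d k}

/-- The values of the variables after the query of the features of point `l` of player `i`'s
trajectory and the computation of the next point. -/
noncomputable def extend (O : Oracles d k) (i : Fin n) (l : ℕ) (σ : Store p) : Store p :=
  Function.update (Function.update σ (.feat i l) (O.feat i (σ.traj i l))) (.traj i (l + 1))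
    (app (σ.mat i) (O.feat i (σ.traj i l)))

theorem mat_extend (O : Oracles d k) (σ : Store p) (i : Fin n) (l : ℕ) :
    (σ.extend O i l).mat i = σ.mat i := by
  simp [mat, extend]

theorem traj_extend_succ (O : Oracles d k) (σ : Store p) (i : Fin n) (l : ℕ) :
    (σ.extend O i l).traj i (l + 1) = app (σ.mat i) (O.feat i (σ.traj i l)) := by
  simp [traj, extend]

/-- The values of the variables after the separation `⟪a, z⟫ ≤ b` of point `l + 1` from player
`i`'s strategy set has been used to correct her matrix. -/
noncomputable def cut (i : Fin n) (l : ℕ) (a : Vec (d i)) (b : ℝ) (σ : Store p) : Store p :=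
  let c := -(b / (‖a‖ ^ 2 * (p.Q : ℝ) ^ 4))
  Function.update (Store.set (Store.set (Function.update σ (.normal i) a) (.level i) () b)
    (.scalar i) () c) (.mat i) (σ.mat i + c • outer a (σ (.feat i l)) : Mat _ _)

/-- A bound on the number of steps left when player `i`'s trajectory has reached length `l`. -/
noncomputable def stepsLeft (σ : Store p) (i : Fin n) (l : ℕ) : ℕ :=
  ⌊‖σ.mat i‖ ^ 2 * (p.Q : ℝ) ^ 5⌋₊ * (p.Q + 1) + (p.Q - l)

end Store

namespace Search

variable {n : ℕ} {Γ : ConcaveGame n} {k : Fin n → ℕ} {p : Params Γ.d k} {O : Oracles Γ.d k}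
  {m : (i : Fin n) → Vec (Γ.d i) → Fin (k i) → ℝ} {i : Fin n} {σ σ' : Store p} {l : ℕ}

theorem refl (h0 : (0 : Vec (Γ.d i)) ∈ Γ.X i) (hσ : σ.traj i 0 = 0) : Search m i σ σ 0 where
  start := hσ
  isTrajectory := ⟨fun l hl => by rwa [Nat.le_zero.1 hl, hσ], fun l hl => absurd hl l.not_lt_zero⟩
  feat l hl := absurd hl l.not_lt_zero
  norm_le _ _ := le_rfl
  eq_of_owner_ne _ _ := rfl

theorem extend (hO : O.Correct Γ m) (h : Search m i σ σ' l)
    (hmem : (σ'.extend O i l).traj i (l + 1) ∈ Γ.X i) :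
    Search m i σ (σ'.extend O i l) (l + 1) := by
  have htraj {l' : ℕ} (hl' : l' ≤ l) : (σ'.extend O i l).traj i l' = σ'.traj i l' := by
    simp [Store.traj, Store.extend, (hl'.trans_lt l.lt_succ_self).ne]
  have hfeat : (σ'.extend O i l) (.feat i l) = m i (σ'.traj i l) := by
    rw [← hO.feat_eq i _ (h.isTrajectory.mem l le_rfl)]
    simp [Store.extend]
  have hnext : (σ'.extend O i l).traj i (l + 1) = app (σ'.mat i) (m i (σ'.traj i l)) := by
    rw [Store.traj_extend_succ, hO.feat_eq i _ (h.isTrajectory.mem l le_rfl)]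
  refine ⟨⟨(htraj l.zero_le).trans h.start, ⟨fun l' hl' => ?_, fun l' hl' => ?_⟩,
    fun l' hl' => ?_, by rw [Store.mat_extend]; exact h.norm_le⟩, fun v hv => ?_⟩
  · rcases Nat.le_succ_iff.1 hl' with hl' | rfl
    exacts [htraj hl' ▸ h.isTrajectory.mem l' hl', hmem]
  · rw [Store.mat_extend, htraj (Nat.lt_succ_iff.1 hl')]
    rcases Nat.lt_succ_iff_lt_or_eq.1 hl' with hl' | rfl
    exacts [(htraj hl').trans (h.isTrajectory.step l' hl'), hnext]
  · rw [htraj (Nat.lt_succ_iff.1 hl')]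
    rcases Nat.lt_succ_iff_lt_or_eq.1 hl' with hl' | rfl
    · rw [← h.feat l' hl']
      simp [Store.extend, hl'.ne]
    · exact hfeat
  · rw [← h.eq_of_owner_ne v hv, Store.extend, Function.update_of_ne, Function.update_of_ne] <;>
    · rintro rfl
      exact hv rfl

theorem stepsLeft_extend_lt (σ' : Store p) (hl : l < p.Q) :
    (σ'.extend O i l).stepsLeft i (l + 1) < σ'.stepsLeft i l := by
  simp only [Store.stepsLeft, Store.mat_extend]
  omega

theorem cut_mat (σ' : Store p) (a : Vec (Γ.d i)) (b : ℝ) :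
    ((σ'.extend O i l).cut i l a b).mat i = σ'.mat i -
      (b / (‖a‖ ^ 2 * (p.Q * (p.Q : ℝ) ^ 3))) • outer a (O.feat i (σ'.traj i l)) := by
  rw [sub_eq_add_neg, ← neg_smul, ← pow_succ']
  simp [Store.cut, Store.extend, Store.mat]

variable {a : Vec (Γ.d i)} {b : ℝ} (hp : p.Dominates m) (hO : O.Correct Γ m)
  (h : Search m i σ σ' l) (hab : ∀ z ∈ Γ.X i, inner ℝ a z ≤ b)
  (hb : b < inner ℝ a ((σ'.extend O i l).traj i (l + 1)))

include hp hO h hab hb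

theorem norm_cut_sub_sq_le {K' : Mat (Γ.d i) (k i)}
    (hK' : ∀ y ∈ Γ.X i, app K' (m i y) ∈ Γ.X i) :
    ‖((σ'.extend O i l).cut i l a b).mat i - (1 - 1 / (p.Q : ℝ)) • K'‖ ^ 2 ≤
      ‖σ'.mat i - (1 - 1 / (p.Q : ℝ)) • K'‖ ^ 2 - 1 / (p.Q : ℝ) ^ 5 := by
  have hl := h.isTrajectory.mem l le_rfl
  rw [Store.traj_extend_succ, hO.feat_eq i _ hl] at hb
  rw [cut_mat, hO.feat_eq i _ hl, pow_add _ 2 3]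
  exact PhiEq.norm_cut_sub_sq_le (hp.closedBall_subset i) hab hb (hK' _ hl) p.one_le_Q
    (by have := p.one_le_Q; positivity) (hp.sum_sq_le i _ hl)

theorem cut : Search m i σ ((σ'.extend O i l).cut i l a b) 0 := by
  have hstart : ((σ'.extend O i l).cut i l a b).traj i 0 = 0 := by
    rw [← h.start]
    simp [Store.traj, Store.cut, Store.set, Store.extend]
  refine ⟨⟨hstart, (refl (hp.zero_mem i) hstart).isTrajectory,
    fun l hl => absurd hl l.not_lt_zero, fun K' hK' => ?_⟩, fun v hv => ?_⟩
  · have : (0 : ℝ) ≤ 1 / (p.Q : ℝ) ^ 5 := by positivity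
    linarith [norm_cut_sub_sq_le hp hO h hab hb hK', h.norm_le K' hK']
  · rw [← h.eq_of_owner_ne v hv]
    rcases v with _ | _ | _ | _ | _ | _ | _ | _ <;>
      simp_all [Params.Var.owner, Store.cut, Store.set, Store.extend]

/-- With the comparator `K' = 0`, the progress of the cut bounds the number of cuts. -/
theorem stepsLeft_cut_lt : ((σ'.extend O i l).cut i l a b).stepsLeft i 0 < σ'.stepsLeft i l := by
  have hQ : (0 : ℝ) < (p.Q : ℝ) ^ 5 := by have := p.one_le_Q; positivity
  have hdecrease := norm_cut_sub_sq_le hp hO h hab hb (K' := 0) fun y _ => by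
    simpa [app_zero] using hp.zero_mem i
  simp only [smul_zero, sub_zero] at hdecrease
  have hfloor : ⌊‖((σ'.extend O i l).cut i l a b).mat i‖ ^ 2 * (p.Q : ℝ) ^ 5⌋₊ <
      ⌊‖σ'.mat i‖ ^ 2 * (p.Q : ℝ) ^ 5⌋₊ := by
    rw [← Nat.add_one_le_iff, Nat.le_floor_iff (by positivity), Nat.cast_succ]
    calc _ ≤ ‖((σ'.extend O i l).cut i l a b).mat i‖ ^ 2 * (p.Q : ℝ) ^ 5 + 1 := by
          gcongr
          exact Nat.floor_le (by positivity)
      _ ≤ (‖σ'.mat i‖ ^ 2 - 1 / (p.Q : ℝ) ^ 5) * (p.Q : ℝ) ^ 5 + 1 := by gcongr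
      _ = ‖σ'.mat i‖ ^ 2 * (p.Q : ℝ) ^ 5 := by
        rw [sub_mul, one_div_mul_cancel hQ.ne', sub_add_cancel]
  have := Nat.mul_le_mul_right (p.Q + 1) hfloor
  simp only [Store.stepsLeft, Nat.succ_mul] at this ⊢
  omega

end Search

namespace Prog

variable {n : ℕ}

/-- `Store.extend` as a program, for the current position. -/
def extend (i : Fin n) : Prog n :=
  .seq (queryFeat i (.var (3 * n + 3))) (mulVec i (.var (3 * n + 3)))

/-- `Store.cut` as a program, for the current position. -/
def cut (i : Fin n) : Prog n :=
  .seq (normSq i)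
    (.seq (.rset (.scalar i) (.ofNat (.const 0) - .mem (.level i) /
        (.mem (.scalar i) * .ofNat (.pow (.size n) 4))))
      (addOuter i (.var (3 * n + 3))))

/-- Compute the next point of player `i`'s trajectory; if it lies outside her strategy set, correct
her matrix and start again. -/
def searchStep (i : Fin n) : Prog n :=
  .seq (extend i)
    (.seq (querySep i (.var (3 * n + 3) + .const 1))
      (.ite (.nlt (.const 0) (.var (3 * n + 4)))
        (.nset (.const (3 * n + 3)) (.var (3 * n + 3) + .const 1))
        (.seq (cut i) (.nset (.const (3 * n + 3)) (.const 0)))))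

/-- Search for a matrix of player `i` that keeps her trajectory inside her strategy set. -/
def search (i : Fin n) : Prog n :=
  .seq (.nset (.const (3 * n + 3)) (.const 0))
    (.loop (.nlt (.var (3 * n + 3)) (.size n)) (searchStep i))

end Prog

section SearchPrograms

variable {n : ℕ} (i : Fin n)

theorem exists_runs_extend : ∃ f : ℕ[X],
    ∀ {d k : Fin n → ℕ} {p : Params d k} {O : Oracles d k} {s : Mem} {σ : Store p} {l : ℕ},
      σ.IsStored s → s.nat (3 * n + 3) = l →
      Runs O p.Q (Prog.extend i) s f (Evolves (3 * n + 5) s (σ.extend O i l)) := by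
  obtain ⟨f, hf⟩ := exists_runs_queryFeat i (.var (3 * n + 3))
  obtain ⟨g, hg⟩ := exists_runs_mulVec i (.var (3 * n + 3))
  refine ⟨f + g, fun {d k p O s σ l} hs hl => Runs.seq (hf (3 * n + 5) hs hl) fun s' hs' =>
    (hg hs'.stored (NExp.keeps_var (by omega) ((hs'.agree _ (by omega)).trans hl))).mono
      fun s'' hs'' => ⟨?_, hs'.agree.trans hs''.agree⟩⟩
  simpa [Store.extend, Store.mat] using hs''.stored

theorem exists_runs_cut : ∃ f : ℕ[X],
    ∀ {d k : Fin n → ℕ} {p : Params d k} {O : Oracles d k} {s : Mem} {σ : Store p} {l : ℕ}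
      {a : Vec (d i)} {b : ℝ},
      Store.IsStored (Store.set (Function.update σ (.normal i) a) (.level i) () b) s →
      s.nat (3 * n + 3) = l →
      Runs O p.Q (Prog.cut i) s f (Evolves (3 * n + 5) s (σ.cut i l a b)) := by
  obtain ⟨f, hf⟩ := exists_runs_normSq i
  obtain ⟨g, hg⟩ := exists_runs_addOuter i (.var (3 * n + 3))
  refine ⟨_, fun {d k p O s σ l a b} hs hl => Runs.seq (hf hs) fun s₁ hs₁ =>
    Runs.seq (Runs.store_rset hs₁.stored (3 * n + 5) hs₁.stored.eval_scalar
      (y := -(b / (‖a‖ ^ 2 * (p.Q : ℝ) ^ 4))) ?_) fun s₂ hs₂ =>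
      (hg hs₂.stored (NExp.keeps_var (by omega) (((hs₁.agree.trans hs₂.agree) _ (by omega)).trans
        hl))).mono fun s₃ hs₃ => ⟨?_, (hs₁.agree.trans hs₂.agree).trans hs₃.agree⟩⟩
  · have hnorm : ‖a‖ ^ 2 = ∑ c, a c ^ 2 := by simp [EuclideanSpace.norm_sq_eq]
    rw [RExp.eval_sub, RExp.eval_div, RExp.eval_mul, hs₁.stored.eval_mem hs₁.stored.eval_level,
      hs₁.stored.eval_mem hs₁.stored.eval_scalar, RExp.eval_ofNat, RExp.eval_ofNat, NExp.eval_pow,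
      hs₁.stored.eval_size, Store.set_apply_self, hnorm]
    simp [Store.set, Store.normal]
  · have hstored := hs₃.stored
    rw [Store.set_set] at hstored
    convert hstored using 1
    rw [Store.cut]
    congr 1
    simp [Store.mat, Store.normal, Store.set]

theorem exists_runs_searchStep : ∃ f : ℕ[X],
    ∀ {Γ : ConcaveGame n} {k : Fin n → ℕ} {p : Params Γ.d k} {O : Oracles Γ.d k}
      {m : (i : Fin n) → Vec (Γ.d i) → Fin (k i) → ℝ} {s : Mem} {σ σ' : Store p},
      O.Correct Γ m → p.Dominates m → σ'.IsStored s → s.nat (3 * n + 3) < p.Q →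
      Search m i σ σ' (s.nat (3 * n + 3)) →
      Runs O p.Q (Prog.searchStep i) s f fun s' => ∃ τ : Store p, Evolves (3 * n + 3) s τ s' ∧
        s'.nat (3 * n + 3) ≤ p.Q ∧ Search m i σ τ (s'.nat (3 * n + 3)) ∧
        τ.stepsLeft i (s'.nat (3 * n + 3)) < σ'.stepsLeft i (s.nat (3 * n + 3)) := by
  obtain ⟨f, hf⟩ := exists_runs_extend i
  obtain ⟨g, hg⟩ := exists_runs_querySep i (.var (3 * n + 3) + .const 1)
  obtain ⟨c, hc⟩ := exists_runs_cut i
  refine ⟨_, fun {Γ k p O m s σ σ'} hO hp hs hl h => Runs.seq (hf hs rfl) fun s₁ hs₁ =>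
    Runs.seq (hg hO hs₁.stored (L := s.nat (3 * n + 3) + 1) ?_) fun s₂ hs₂ =>
      Runs.ite (fun hflag => Runs.nset ?_) fun hflag =>
        have ⟨a, b, hb, hab, _, hs₂⟩ :=
          hs₂.resolve_left fun h => hflag (by simp [BExp.holds, h.2.1])
        Runs.seq (hc hs₂.stored (l := s.nat (3 * n + 3)) ?_) fun s₃ hs₃ => Runs.nset ?_⟩
  · simp [hs₁.agree (3 * n + 3) (by omega)]
  · obtain ⟨hmem, -, hs₂⟩ := hs₂.resolve_right (by
      rintro ⟨_, _, _, _, h, _⟩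
      simp [BExp.holds, h] at hflag)
    have hagree := (hs₁.agree.mono (by omega)).trans hs₂.agree
    have hpos := hagree (3 * n + 3) (by omega)
    refine ⟨_, ⟨hs₂.stored.setNat (by simp; omega),
      (hagree.mono (by omega)).setNat le_rfl⟩, ?_⟩
    simp only [NExp.eval_const, NExp.eval_add, NExp.eval_var, Mem.setNat_nat, if_true, hpos]
    exact ⟨hl, h.extend hO hmem, Search.stepsLeft_extend_lt σ' hl⟩
  · exact ((hs₁.agree.mono (by omega)).trans hs₂.agree) _ (by omega)
  · have hagree := ((hs₁.agree.mono (by omega)).trans hs₂.agree).trans (hs₃.agree.mono (by omega))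
    refine ⟨_, ⟨hs₃.stored.setNat (by simp; omega),
      (hagree.mono (by omega)).setNat le_rfl⟩, ?_⟩
    simp only [NExp.eval_const, Mem.setNat_nat, if_true]
    exact ⟨p.Q.zero_le, h.cut hp hO hab hb, h.stepsLeft_cut_lt hp hO hab hb⟩

theorem exists_runs_search : ∃ f : ℕ[X],
    ∀ {Γ : ConcaveGame n} {k : Fin n → ℕ} {p : Params Γ.d k} {O : Oracles Γ.d k}
      {m : (i : Fin n) → Vec (Γ.d i) → Fin (k i) → ℝ} {s : Mem} {σ : Store p},
      O.Correct Γ m → p.Dominates m → σ.IsStored s → σ.traj i 0 = 0 →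
      ‖σ.mat i‖ ^ 2 ≤ 3 * (p.Q : ℝ) ^ 8 →
      Runs O p.Q (Prog.search i) s f fun s' =>
        ∃ τ : Store p, Evolves (3 * n + 3) s τ s' ∧ Search m i σ τ p.Q := by
  obtain ⟨f, hf⟩ := exists_runs_searchStep i
  refine ⟨_, fun {Γ k p O m s σ} hO hp hs hstart hnorm =>
    Runs.seq (Runs.nset (post := fun s' => σ.IsStored s' ∧ AgreeBelow (3 * n + 3) s s' ∧
      s'.nat (3 * n + 3) = 0) ?_) fun s₁ hs₁ =>
    (Runs.loop (f := f) (g := 3 * X ^ 13 * (X + 1) + X)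
      (fun s' => ∃ τ : Store p, Evolves (3 * n + 3) s τ s' ∧ s'.nat (3 * n + 3) ≤ p.Q ∧
        Search m i σ τ (s'.nat (3 * n + 3)))
      (fun s' => (Store.ofMem p s').stepsLeft i (s'.nat (3 * n + 3))) ?_ ?_ ?_).mono ?_⟩
  · exact ⟨hs.setNat (by simp; omega), (AgreeBelow.refl _ s).setNat le_rfl, by simp⟩
  · rintro s₂ ⟨τ, hs₂, -, h⟩ hlt
    rw [BExp.holds, hs₂.stored.eval_size] at hlt
    rw [hs₂.stored.ofMem_eq]
    refine (hf hO hp hs₂.stored hlt h).mono fun s₃ ⟨τ', hs₃, hle, h', hdecrease⟩ => ?_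
    rw [hs₃.stored.ofMem_eq]
    exact ⟨⟨τ', ⟨hs₃.stored, hs₂.agree.trans hs₃.agree⟩, hle, h'⟩, hdecrease⟩
  · obtain ⟨hs₁, hagree, hpos⟩ := hs₁
    rw [hpos]
    exact ⟨σ, ⟨hs₁, hagree⟩, Nat.zero_le _, .refl (hp.zero_mem i) hstart⟩
  · obtain ⟨hs₁, -, hpos⟩ := hs₁
    have hfloor : ⌊‖σ.mat i‖ ^ 2 * (p.Q : ℝ) ^ 5⌋₊ ≤ 3 * p.Q ^ 13 := by
      refine Nat.floor_le_of_le ?_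
      push_cast
      nlinarith [mul_le_mul_of_nonneg_right hnorm (by positivity : (0 : ℝ) ≤ (p.Q : ℝ) ^ 5)]
    simpa [hs₁.ofMem_eq, hpos, Store.stepsLeft] using Nat.mul_le_mul_right (p.Q + 1) hfloor
  · rintro s₂ ⟨⟨τ, hs₂, hle, h⟩, hge⟩
    rw [BExp.holds, hs₂.stored.eval_size] at hge
    have hpos : s₂.nat (3 * n + 3) = p.Q := hle.antisymm (not_lt.1 hge)
    exact ⟨τ, hs₂, hpos ▸ h⟩

end SearchPrograms

theorem Settled.congr {n : ℕ} {Γ : ConcaveGame n} {k : Fin n → ℕ} {p : Params Γ.d k}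
    {m : (i : Fin n) → Vec (Γ.d i) → Fin (k i) → ℝ} {i : Fin n} {σ₁ σ₂ τ₁ τ₂ : Store p} {l : ℕ}
    (h : Settled m i σ₁ τ₁ l) (hσ : σ₂ (.mat i) = σ₁ (.mat i))
    (hτ : ∀ v : p.Var, v.owner = some i → τ₂ v = τ₁ v) : Settled m i σ₂ τ₂ l := by
  have hmat : τ₂.mat i = τ₁.mat i := Store.mat_congr (hτ _ rfl)
  have htraj : τ₂.traj i = τ₁.traj i := Store.traj_congr fun _ => hτ _ rfl
  have hmat' : σ₂.mat i = σ₁.mat i := Store.mat_congr hσ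
  refine ⟨htraj ▸ h.start, ?_, fun l' hl' => ?_, ?_⟩
  · rw [hmat, htraj]
    exact h.isTrajectory
  · rw [htraj, hτ _ rfl, h.feat l' hl']
  · rw [hmat, hmat']
    exact h.norm_le

theorem exists_runs_seqs_search (n : ℕ) : ∃ f : ℕ[X],
    ∀ {Γ : ConcaveGame n} {k : Fin n → ℕ} {p : Params Γ.d k} {O : Oracles Γ.d k}
      {m : (i : Fin n) → Vec (Γ.d i) → Fin (k i) → ℝ} {s : Mem} {σ : Store p},
      O.Correct Γ m → p.Dominates m → σ.IsStored s → (∀ i, σ.traj i 0 = 0) →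
      (∀ i, ‖σ.mat i‖ ^ 2 ≤ 3 * (p.Q : ℝ) ^ 8) →
      Runs O p.Q (Prog.seqs Prog.search) s f fun s' => ∃ τ : Store p, Evolves (3 * n + 3) s τ s' ∧
        (∀ i, Settled m i σ τ p.Q) ∧ ∀ v : p.Var, v.owner = none → τ v = σ v := by
  choose f hf using exists_runs_search (n := n)
  refine ⟨_, fun {Γ k p O m s σ} hO hp hs hstart hnorm =>
    (Runs.seqs (f := f) (fun j s' => ∃ τ : Store p, Evolves (3 * n + 3) s τ s' ∧
      (∀ i : Fin n, i < j → Settled m i σ τ p.Q) ∧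
      ∀ v : p.Var, (∀ i : Fin n, v.owner = some i → j ≤ i) → τ v = σ v) ?_ ?_).mono ?_⟩
  · exact ⟨σ, hs.evolves _, fun i hi => absurd hi i.val.not_lt_zero, fun _ _ => rfl⟩
  · rintro i s₁ ⟨τ, hs₁, hsettled, hframe⟩
    have hown (v : p.Var) (hv : v.owner = some i) : τ v = σ v :=
      hframe v fun i' hi' => by rw [Option.some.inj (hv.symm.trans hi')]
    refine (hf i hO hp hs₁.stored ?_ ?_).mono fun s₂ ⟨τ', hs₂, h⟩ =>
      ⟨τ', ⟨hs₂.stored, hs₁.agree.trans hs₂.agree⟩, fun i' hi' => ?_, fun v hv => ?_⟩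
    · rw [Store.traj_congr fun _ => hown _ rfl]
      exact hstart i
    · rw [Store.mat_congr (hown _ rfl)]
      exact hnorm i
    · rcases Nat.lt_succ_iff_lt_or_eq.1 hi' with hi' | hi'
      · exact (hsettled i' hi').congr rfl fun v hv => h.eq_of_owner_ne v fun hv' => by
          simp_all
      · obtain rfl := Fin.ext hi'
        exact h.toSettled.congr (hown _ rfl).symm fun _ _ => rfl
    · rw [h.eq_of_owner_ne v fun hv' => by simpa using hv i hv',
        hframe v fun i' hi' => i.val.le_succ.trans (hv i' hi')]
  · rintro s₁ ⟨τ, hs₁, hsettled, hframe⟩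
    exact ⟨τ, hs₁, fun i => hsettled i i.2, fun v hv => hframe v fun i hi => by simp [hv] at hi⟩

/-! ### Playing and gradient steps -/

namespace Prog

variable {n : ℕ}

/-- Player `i`'s gradient step for the profile listed last. Her entry of this profile is replaced by
the next point of her trajectory while the supergradient is queried. -/
def gradientStep (i : Fin n) : Prog n :=
  .seq (copy i (.var (2 * n + 3 + i) + .const 1) (.var (2 * n + 2)))
    (.seq (queryGrad i (.var (2 * n + 2)))
      (.seq (.rset (.scalar i) (.ofNat (.const 1) / .ofNat (.pow (.size n) (n + 4))))
        (.seq (addOuter i (.var (2 * n + 3 + i)))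
          (copy i (.var (2 * n + 3 + i)) (.var (2 * n + 2))))))

/-- List the profile picked out of the trajectories by the current times of the players. -/
def list (n : ℕ) : Prog n :=
  .seq (seqs fun i => copy i (.var (2 * n + 3 + i)) (.var (2 * n + 2)))
    (.rset (.weight n (.var (2 * n + 2)))
      (.ofNat (.const 1) / .ofNat (.pow (.size n) (n + 7))))

/-- List the next profile and let all players react to it. -/
def play (n : ℕ) : Prog n :=
  .seq (list n)
    (.seq (seqs gradientStep) (.nset (.const (2 * n + 2)) (.var (2 * n + 2) + .const 1)))

end Prog

/-- The player whose gradient step may change a variable. -/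
def Params.Var.stepper {n : ℕ} {d k : Fin n → ℕ} {p : Params d k} : p.Var → Option (Fin n)
  | .mat i | .normal i | .scalar i => some i
  | .weight _ | .point _ _ | .traj _ _ | .feat _ _ | .level _ => none

/-- The number of the listed point that a variable belongs to. -/
def Params.Var.output {n : ℕ} {d k : Fin n → ℕ} {p : Params d k} : p.Var → Option (Fin p.points)
  | .weight r | .point r _ => some r
  | .mat _ | .traj _ _ | .feat _ _ | .normal _ | .level _ | .scalar _ => none

theorem Store.point_update {n : ℕ} {d k : Fin n → ℕ} {p : Params d k} (σ : Store p)
    (R : Fin p.points) (i : Fin n) (x : Vec (d i)) :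
    Store.point (Function.update σ (.point R i) x) R = Function.update (σ.point R) i x := by
  funext j
  by_cases hj : j = i
  · subst hj
    simp [Store.point]
  · simp [Store.point, hj]

theorem exists_runs_gradientStep {n : ℕ} (i : Fin n) : ∃ f : ℕ[X],
    ∀ {d k : Fin n → ℕ} {p : Params d k} {O : Oracles d k} {s : Mem} {σ : Store p}
      {R : Fin p.points} {L : ℕ}, σ.IsStored s → s.nat (2 * n + 2) = R →
      s.nat (2 * n + 3 + i) = L → σ (.point R i) = σ.traj i L →
      Runs O p.Q (Prog.gradientStep i) s f fun s' => ∃ τ : Store p, Evolves (3 * n + 5) s τ s' ∧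
        τ.mat i = σ.mat i + (1 / (p.Q : ℝ) ^ (n + 4)) •
          outer (O.grad i (Function.update (σ.point R) i (σ.traj i (L + 1)))) (σ (.feat i L)) ∧
        ∀ v : p.Var, v.stepper ≠ some i → τ v = σ v := by
  obtain ⟨f, hf⟩ := exists_runs_copy i (.var (2 * n + 3 + i) + .const 1) (.var (2 * n + 2))
  obtain ⟨g, hg⟩ := exists_runs_queryGrad i (.var (2 * n + 2))
  obtain ⟨a, ha⟩ := exists_runs_addOuter i (.var (2 * n + 3 + i))
  obtain ⟨c, hc⟩ := exists_runs_copy i (.var (2 * n + 3 + i)) (.var (2 * n + 2))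
  refine ⟨_, fun {d k p O s σ R L} hs hR hL hpoint =>
    have hR {s' : Mem} (h : AgreeBelow (3 * n + 5) s s') :=
      NExp.keeps_var (a := 2 * n + 2) (h := 3 * n + 5) (by omega) ((h _ (by omega)).trans hR)
    have hL {s' : Mem} (h : AgreeBelow (3 * n + 5) s s') :=
      NExp.keeps_var (a := 2 * n + 3 + i) (h := 3 * n + 5) (by omega) ((h _ (by omega)).trans hL)
    Runs.seq (hf hs (hL (.refl _ s)).succ (hR (.refl _ s))) fun s₁ hs₁ =>
    Runs.seq (hg (3 * n + 5) hs₁.stored (hR hs₁.agree s₁ (.refl _ s₁))) fun s₂ hs₂ =>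
    Runs.seq (Runs.store_rset hs₂.stored (3 * n + 5) hs₂.stored.eval_scalar
      (y := 1 / (p.Q : ℝ) ^ (n + 4)) (by simp [hs₂.stored.eval_size])) fun s₃ hs₃ =>
    have h₃ := (hs₁.agree.trans hs₂.agree).trans hs₃.agree
    Runs.seq (ha hs₃.stored (hL h₃)) fun s₄ hs₄ =>
      (hc hs₄.stored (hL (h₃.trans hs₄.agree)) (hR (h₃.trans hs₄.agree))).mono fun s₅ hs₅ =>
        ⟨_, ⟨hs₅.stored, (h₃.trans hs₄.agree).trans hs₅.agree⟩, ?_, fun v hv => ?_⟩⟩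
  · simp [Store.mat, Store.normal, Store.set, Store.point_update]
  · by_cases hv' : v = .point R i
    · subst hv'
      simp [Store.traj, Store.set, hpoint]
    · have hne (w : p.Var) (hw : w.stepper = some i) : v ≠ w := fun h => hv (h ▸ hw)
      rw [Function.update_of_ne hv', Function.update_of_ne (hne _ rfl), Store.set_of_ne (hne _ rfl),
        Function.update_of_ne (hne _ rfl), Function.update_of_ne hv']

theorem exists_runs_list (n : ℕ) : ∃ f : ℕ[X],
    ∀ {d k : Fin n → ℕ} {p : Params d k} {O : Oracles d k} {s : Mem} {σ : Store p}
      {R : Fin p.points} {ℓ : Fin n → ℕ}, σ.IsStored s → s.nat (2 * n + 2) = R →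
      (∀ i : Fin n, s.nat (2 * n + 3 + i) = ℓ i) →
      Runs O p.Q (Prog.list n) s f fun s' => ∃ τ : Store p, Evolves (3 * n + 5) s τ s' ∧
        τ (.weight R) () = 1 / (p.Q : ℝ) ^ (n + 7) ∧ τ.point R = pick σ.traj ℓ ∧
        ∀ v : p.Var, v.output ≠ some R → τ v = σ v := by
  choose f hf using fun i : Fin n => exists_runs_copy i (.var (2 * n + 3 + i)) (.var (2 * n + 2))
  refine ⟨_, fun {d k p O s σ R ℓ} hs hR hℓ =>
    Runs.seq (Runs.seqs (f := f) (fun j s' => ∃ τ : Store p, Evolves (3 * n + 5) s τ s' ∧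
      (∀ i : Fin n, i < j → τ (.point R i) = σ.traj i (ℓ i)) ∧
      ∀ v : p.Var, v.output ≠ some R → τ v = σ v) ?_ ?_) fun s₁ ⟨τ, hs₁, hpoint, hframe⟩ =>
    (Runs.store_rset hs₁.stored (3 * n + 5) (hs₁.stored.eval_weight ?_)
      (y := 1 / (p.Q : ℝ) ^ (n + 7)) (by simp [hs₁.stored.eval_size])).mono fun s₂ hs₂ =>
        ⟨_, ⟨hs₂.stored, hs₁.agree.trans hs₂.agree⟩, Store.set_apply_self, ?_, fun v hv => ?_⟩⟩
  · exact ⟨σ, hs.evolves _, fun i hi => absurd hi i.val.not_lt_zero, fun _ _ => rfl⟩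
  · rintro i s₁ ⟨τ, hs₁, hpoint, hframe⟩
    have hkeeps {a x : ℕ} (ha : a < 3 * n + 5) (hx : s.nat a = x) :=
      NExp.keeps_var ha ((hs₁.agree a ha).trans hx)
    refine (hf i hs₁.stored (hkeeps (by omega) (hℓ i)) (hkeeps (by omega) hR)).mono fun s₂ hs₂ =>
      ⟨_, ⟨hs₂.stored, hs₁.agree.trans hs₂.agree⟩, fun i' hi' => ?_, fun v hv => ?_⟩
    · rcases Nat.lt_succ_iff_lt_or_eq.1 hi' with hi' | hi'
      · rw [Function.update_of_ne (by simp; omega), hpoint i' hi']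
      · obtain rfl := Fin.ext hi'
        rw [Function.update_self, Store.traj, hframe _ (by simp [Params.Var.output]), Store.traj]
    · rw [Function.update_of_ne (by rintro rfl; exact hv rfl), hframe v hv]
  · exact (hs₁.agree (2 * n + 2) (by omega)).trans hR
  · funext i
    rw [Store.point, Store.set_of_ne (by simp), hpoint i i.2, pick]
  · rw [Store.set_of_ne (by rintro rfl; exact hv rfl), hframe v hv]

/-- The values `σ'` arise from `σ` by listing the profile at the times `ℓ` as point `r` and letting
all players react to it. -/
structure Played {n : ℕ} {d k : Fin n → ℕ} {p : Params d k} (O : Oracles d k) (r : Fin p.points)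
    (ℓ : Fin n → ℕ) (σ σ' : Store p) : Prop where
  weight : σ' (.weight r) () = 1 / (p.Q : ℝ) ^ (n + 7)
  point : σ'.point r = pick σ.traj ℓ
  mat : ∀ i, σ'.mat i = σ.mat i + (1 / (p.Q : ℝ) ^ (n + 4)) •
    outer (O.grad i (advance σ.traj ℓ i)) (σ (.feat i (ℓ i)))
  frame : ∀ v : p.Var, v.output ≠ some r → v.stepper = none → σ' v = σ v

theorem exists_runs_seqs_gradientStep (n : ℕ) : ∃ f : ℕ[X],
    ∀ {d k : Fin n → ℕ} {p : Params d k} {O : Oracles d k} {s : Mem} {σ : Store p}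
      {R : Fin p.points} {ℓ : Fin n → ℕ}, σ.IsStored s → s.nat (2 * n + 2) = R →
      (∀ i : Fin n, s.nat (2 * n + 3 + i) = ℓ i) → σ.point R = pick σ.traj ℓ →
      Runs O p.Q (Prog.seqs Prog.gradientStep) s f fun s' =>
        ∃ τ : Store p, Evolves (3 * n + 5) s τ s' ∧
          (∀ i, τ.mat i = σ.mat i + (1 / (p.Q : ℝ) ^ (n + 4)) •
            outer (O.grad i (advance σ.traj ℓ i)) (σ (.feat i (ℓ i)))) ∧
          ∀ v : p.Var, v.stepper = none → τ v = σ v := by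
  choose f hf using exists_runs_gradientStep (n := n)
  refine ⟨_, fun {d k p O s σ R ℓ} hs hR hℓ hpoint =>
    (Runs.seqs (f := f) (fun j s' => ∃ τ : Store p, Evolves (3 * n + 5) s τ s' ∧
      (∀ i : Fin n, i < j → τ.mat i = σ.mat i + (1 / (p.Q : ℝ) ^ (n + 4)) •
        outer (O.grad i (advance σ.traj ℓ i)) (σ (.feat i (ℓ i)))) ∧
      ∀ v : p.Var, (∀ i : Fin n, v.stepper = some i → j ≤ i) → τ v = σ v) ?_ ?_).mono ?_⟩
  · exact ⟨σ, hs.evolves _, fun i hi => absurd hi i.val.not_lt_zero, fun _ _ => rfl⟩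
  · rintro i s₁ ⟨τ, hs₁, hmat, hframe⟩
    have heq (v : p.Var) (hv : v.stepper = none) : τ v = σ v := hframe v fun i hi => by simp_all
    have htraj : τ.traj = σ.traj := funext fun i => Store.traj_congr fun _ => heq _ rfl
    have hpoint' : τ.point R = pick σ.traj ℓ :=
      (Store.point_congr fun _ => heq _ rfl).trans hpoint
    refine (hf i hs₁.stored ((hs₁.agree _ (by omega)).trans hR)
      ((hs₁.agree _ (by omega)).trans (hℓ i)) ?_).mono
        fun s₂ ⟨τ', hs₂, hmat', hframe'⟩ =>
          ⟨τ', ⟨hs₂.stored, hs₁.agree.trans hs₂.agree⟩, fun i' hi' => ?_, fun v hv => ?_⟩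
    · rw [htraj]
      exact congrArg (fun y : Profile d => (y i : Fin (d i) → ℝ)) hpoint'
    · rcases Nat.lt_succ_iff_lt_or_eq.1 hi' with hi' | hi'
      · rw [← hmat i' hi']
        exact Store.mat_congr (hframe' _ (by simp [Params.Var.stepper]; omega))
      · obtain rfl := Fin.ext hi'
        have hself : τ (.mat i') = σ (.mat i') :=
          hframe _ fun _ hi => (congrArg Fin.val (Option.some.inj hi)).le
        rw [hmat', Store.mat_congr hself, htraj, hpoint', heq _ rfl, advance]
    · rw [hframe' v fun hv' => by simpa using hv i hv',
        hframe v fun i' hi' => i.val.le_succ.trans (hv i' hi')]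
  · rintro s₁ ⟨τ, hs₁, hmat, hframe⟩
    exact ⟨τ, hs₁, fun i => hmat i i.2, fun v hv => hframe v fun i hi => by simp [hv] at hi⟩

theorem exists_runs_play (n : ℕ) : ∃ f : ℕ[X],
    ∀ {d k : Fin n → ℕ} {p : Params d k} {O : Oracles d k} {s : Mem} {σ : Store p}
      {R : Fin p.points} {ℓ : Fin n → ℕ}, σ.IsStored s → s.nat (2 * n + 2) = R →
      (∀ i : Fin n, s.nat (2 * n + 3 + i) = ℓ i) →
      Runs O p.Q (Prog.play n) s f fun s' => s'.nat (2 * n + 2) = R + 1 ∧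
        (∀ i : Fin n, s'.nat (2 * n + 3 + i) = ℓ i) ∧
        ∃ τ : Store p, Evolves (2 * n + 2) s τ s' ∧ Played O R ℓ σ τ := by
  obtain ⟨f, hf⟩ := exists_runs_list n
  obtain ⟨g, hg⟩ := exists_runs_seqs_gradientStep n
  refine ⟨_, fun {d k p O s σ R ℓ} hs hR hℓ =>
    Runs.seq (hf hs hR hℓ) fun s₁ ⟨τ, hs₁, hweight, hpoint, hframe⟩ =>
    have htraj : τ.traj = σ.traj := funext fun _ => Store.traj_congr fun _ => hframe _ nofun
    Runs.seq (hg hs₁.stored ((hs₁.agree _ (by omega)).trans hR)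
      (fun i => (hs₁.agree _ (by omega)).trans (hℓ i)) (by rw [hpoint, htraj]))
      fun s₂ ⟨τ', hs₂, hmat, hframe'⟩ => Runs.nset ?_⟩
  have hnat {a : ℕ} (ha : a < 3 * n + 5) : s₂.nat a = s.nat a := (hs₁.agree.trans hs₂.agree) a ha
  simp only [NExp.eval_const, NExp.eval_add, NExp.eval_var]
  refine ⟨by rw [Mem.setNat_nat, if_pos rfl, hnat (by omega), hR],
    fun i => by rw [Mem.setNat_nat, if_neg (by omega), hnat (by omega), hℓ], τ',
    ⟨hs₂.stored.setNat (by omega), ((hs₁.agree.trans hs₂.agree).mono (by omega)).setNat le_rfl⟩, ?_⟩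
  refine ⟨(congrFun (hframe' (.weight R) rfl) ()).trans hweight,
    (Store.point_congr fun _ => hframe' _ rfl).trans hpoint, fun i => ?_,
    fun v hv hv' => (hframe' v hv').trans (hframe v hv)⟩
  rw [hmat, htraj, Store.mat_congr (hframe (.mat i) nofun), hframe (.feat i (ℓ i)) nofun]

/-! ### Playing a round -/

/-- The `n` lowest digits of `a` to the base `b`, the lowest one first: the times of the players at
which profile number `a` of a round is played. -/
def digits (n b a : ℕ) (j : Fin n) : ℕ := a / b ^ (j : ℕ) % b

theorem digits_lt {n b : ℕ} (hb : 0 < b) (a : ℕ) (j : Fin n) : digits n b a j < b :=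
  Nat.mod_lt _ hb

theorem sum_range_digits {α : Type*} [AddCommMonoid α] (n b : ℕ) (F : (Fin n → ℕ) → α) :
    ∑ a ∈ Finset.range (b ^ n), F (digits n b a) = ∑ ℓ : Fin n → Fin b, F fun j => ℓ j := by
  rw [Finset.sum_range]
  exact Fintype.sum_equiv finFunctionFinEquiv.symm _ _ fun _ => rfl

/-- The profile listed as point number `r` of the output, for `r < p.points`. -/
noncomputable def Store.profile {n : ℕ} {d k : Fin n → ℕ} {p : Params d k} (σ : Store p) (r : ℕ) :
    Profile d :=
  if h : r < p.points then σ.point ⟨r, h⟩ else 0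

/-- The values `σ'` arise from `σ` by playing the first `a` profiles of a round, which are listed
from point number `r₀` on. -/
structure InRound {n : ℕ} {d k : Fin n → ℕ} {p : Params d k} (O : Oracles d k) (r₀ : ℕ)
    (σ : Store p) (a : ℕ) (σ' : Store p) : Prop where
  weight : ∀ r : Fin p.points, r₀ ≤ r → r < r₀ + a → σ' (.weight r) () = 1 / (p.Q : ℝ) ^ (n + 7)
  profile : ∀ b < a, σ'.profile (r₀ + b) = pick σ.traj (digits n p.Q b)
  mat : ∀ i, σ'.mat i = σ.mat i + (1 / (p.Q : ℝ) ^ (n + 4)) • ∑ b ∈ Finset.range a,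
    outer (O.grad i (advance σ.traj (digits n p.Q b) i)) (σ (.feat i (digits n p.Q b i)))
  frame : ∀ v : p.Var, v.stepper = none → (∀ r, v.output = some r → r < r₀) → σ' v = σ v

namespace InRound

variable {n : ℕ} {d k : Fin n → ℕ} {p : Params d k} {O : Oracles d k} {r₀ a : ℕ}
  {σ σ' σ'' : Store p}

theorem refl (O : Oracles d k) (r₀ : ℕ) (σ : Store p) : InRound O r₀ σ 0 σ where
  weight r hr hr' := by omega
  profile b hb := absurd hb b.not_lt_zero
  mat i := by simp
  frame _ _ _ := rfl

theorem succ (h : InRound O r₀ σ a σ') {r : Fin p.points} (hr : (r : ℕ) = r₀ + a)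
    (h' : Played O r (digits n p.Q a) σ' σ'') : InRound O r₀ σ (a + 1) σ'' := by
  have htraj : σ'.traj = σ.traj := funext fun i => Store.traj_congr fun _ => h.frame _ rfl nofun
  refine ⟨fun r' hr' hlt => ?_, fun b hb => ?_, fun i => ?_, fun v hv hlt => ?_⟩
  · by_cases heq : r' = r
    · rw [heq, h'.weight]
    · have hne : (r' : ℕ) ≠ r := fun he => heq (Fin.ext he)
      rw [h'.frame _ (by simpa [Params.Var.output]) rfl, h.weight r' hr' (by omega)]
  · rcases Nat.lt_succ_iff_lt_or_eq.1 hb with hb | rfl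
    · rw [← h.profile b hb]
      simp only [Store.profile]
      split_ifs with hlt
      · have hne : (⟨r₀ + b, hlt⟩ : Fin p.points) ≠ r := Fin.ne_of_val_ne (by simp only; omega)
        exact Store.point_congr fun _ => h'.frame _ (by simpa [Params.Var.output]) rfl
      · rfl
    · rw [← htraj, ← h'.point, Store.profile, dif_pos (hr ▸ r.2)]
      exact congrArg σ''.point (Fin.ext hr.symm)
  · rw [h'.mat, h.mat, htraj, h.frame (.feat i _) rfl nofun, Finset.sum_range_succ, smul_add,
      add_assoc]
  · rw [h'.frame v (fun hout => ?_) hv, h.frame v hv hlt]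
    have := hlt r hout
    omega

end InRound

namespace Prog

variable {n : ℕ}

/-- One round: all players compute trajectories, and all profiles picked out of them are played. -/
def round (n : ℕ) : Prog n :=
  .seq (seqs search) (nest (2 * n + 3) (.size n) (play n) n)

end Prog

theorem exists_runs_nest_play (n : ℕ) : ∃ f : ℕ[X],
    ∀ {d k : Fin n → ℕ} {p : Params d k} {O : Oracles d k} {s : Mem} {σ : Store p} {r₀ : ℕ},
      σ.IsStored s → s.nat (2 * n + 2) = r₀ → r₀ + p.Q ^ n ≤ p.points →
      Runs O p.Q (Prog.nest (2 * n + 3) (.size n) (Prog.play n) n) s f fun s' =>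
        s'.nat (2 * n + 2) = r₀ + p.Q ^ n ∧
        ∃ τ : Store p, Evolves (2 * n + 2) s τ s' ∧ InRound O r₀ σ (p.Q ^ n) τ := by
  obtain ⟨f, hf⟩ := exists_runs_play n
  refine ⟨_, fun {d k p O s σ r₀} hs hr₀ hle =>
    (Runs.nest (τ₀ := 0) (g := X) (f := f) (fun a s' => s'.nat (2 * n + 2) = r₀ + a ∧
      ∃ τ : Store p, Evolves (2 * n + 2) s τ s' ∧ InRound O r₀ σ a τ)
      ⟨hr₀, σ, hs.evolves _, .refl O r₀ σ⟩ (dvd_zero _) (B := p.Q) (by simp) ?_ ?_ ?_).mono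
      fun s' h => by rwa [zero_add] at h⟩
  · rintro a s' ⟨-, τ, hτ, -⟩
    exact hτ.stored.eval_size
  · rintro a s' j x - ⟨hnat, τ, hτ, hround⟩
    exact ⟨by rw [Mem.setNat_nat, if_neg (by omega), hnat], τ,
      ⟨hτ.stored.setNat (by omega), hτ.agree.setNat (by omega)⟩, hround⟩
  · rintro a s' - ha ⟨hnat, τ, hτ, hround⟩ hdigits
    refine (hf (R := ⟨r₀ + a, by omega⟩) (ℓ := digits n p.Q a) hτ.stored hnat
      fun i => hdigits i i.2).mono fun s'' ⟨hnat', hdigits', τ', hτ', hplayed⟩ =>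
        ⟨fun j hj => ?_, hnat', τ', ⟨hτ'.stored, hτ.agree.trans hτ'.agree⟩,
          hround.succ rfl hplayed⟩
    exact (hdigits' ⟨j, hj⟩).trans (hdigits j hj).symm

theorem exists_runs_round (n : ℕ) : ∃ f : ℕ[X],
    ∀ {Γ : ConcaveGame n} {k : Fin n → ℕ} {m : (i : Fin n) → Vec (Γ.d i) → Fin (k i) → ℝ}
      {O : Oracles Γ.d k} {p : Params Γ.d k} {s : Mem} {σ : Store p} {r₀ : ℕ},
      O.Correct Γ m → p.Dominates m → σ.IsStored s → (∀ i, σ.traj i 0 = 0) →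
      (∀ i, ‖σ.mat i‖ ^ 2 ≤ 3 * (p.Q : ℝ) ^ 8) → s.nat (2 * n + 2) = r₀ →
      r₀ + p.Q ^ n ≤ p.points →
      Runs O p.Q (Prog.round n) s f fun s' => s'.nat (2 * n + 2) = r₀ + p.Q ^ n ∧
        ∃ τ τ' : Store p, (∀ i, Settled m i σ τ p.Q) ∧
          (∀ v : p.Var, v.owner = none → τ v = σ v) ∧ InRound O r₀ τ (p.Q ^ n) τ' ∧
          Evolves (2 * n + 2) s τ' s' := by
  obtain ⟨f, hf⟩ := exists_runs_seqs_search n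
  obtain ⟨g, hg⟩ := exists_runs_nest_play n
  exact ⟨_, fun {Γ k m O p s σ r₀} hO hp hs h0 hnorm hr₀ hle =>
    Runs.seq (hf hO hp hs h0 hnorm) fun s₁ ⟨τ, hτ, hsettled, hframe⟩ =>
    (hg hτ.stored ((hτ.agree _ (by omega)).trans hr₀) hle).mono
      fun s₂ ⟨hnat, τ', hτ', hround⟩ => ⟨hnat, τ, τ', hsettled, hframe, hround, hτ'.stored,
        (hτ.agree.mono (by omega)).trans hτ'.agree⟩⟩

/-! ### Regret of the algorithm -/

section Round

variable {n : ℕ} {Γ : ConcaveGame n} {k : Fin n → ℕ} {p : Params Γ.d k} {O : Oracles Γ.d k}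
  {m : (i : Fin n) → Vec (Γ.d i) → Fin (k i) → ℝ} {r₀ t : ℕ} {σ τ σ' : Store p} {i : Fin n}

theorem InRound.profile_mem (hround : InRound O r₀ τ (p.Q ^ n) σ')
    (hsettled : ∀ i, Settled m i σ τ p.Q) {b : ℕ} (hb : b < p.Q ^ n) :
    σ'.profile (r₀ + b) ∈ Γ.profiles := by
  rw [hround.profile b hb]
  exact pick_mem_profiles (fun j => (hsettled j).isTrajectory.mem)
    fun j => (digits_lt p.Q_pos b j).le

theorem InRound.profile_eq (hround : InRound O r₀ τ (p.Q ^ n) σ')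
    (hframe : ∀ v : p.Var, v.owner = none → τ v = σ v) {r : ℕ} (hr : r < r₀) :
    σ'.profile r = σ.profile r := by
  simp only [Store.profile]
  split_ifs
  · exact Store.point_congr fun _ => (hround.frame _ rfl (by rintro _ ⟨⟩; exact hr)).trans
      (hframe _ rfl)
  · rfl

theorem InRound.mat_eq (hround : InRound O r₀ τ (p.Q ^ n) σ')
    (hsettled : ∀ i, Settled m i σ τ p.Q) (i : Fin n) :
    σ'.mat i = τ.mat i + (1 / ((p.Q : ℝ) ^ 3 * p.Q * (p.Q : ℝ) ^ n)) •
      ∑ ℓ : Fin n → Fin p.Q, roundGradient O m τ.traj i (ℓ ·) := by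
  rw [hround.mat, ← sum_range_digits n p.Q (roundGradient O m τ.traj i),
    show (p.Q : ℝ) ^ 3 * p.Q * (p.Q : ℝ) ^ n = (p.Q : ℝ) ^ (n + 4) by ring]
  congr 2
  refine Finset.sum_congr rfl fun b _ => ?_
  rw [roundGradient, (hsettled i).feat _ (digits_lt p.Q_pos b i)]

theorem InRound.sum_gain_le (hO : O.Correct Γ m) (hp : p.Dominates m)
    (hround : InRound O r₀ τ (p.Q ^ n) σ') (hsettled : ∀ i, Settled m i σ τ p.Q)
    {φ : Vec (Γ.d i) → Vec (Γ.d i)} {K' : Mat (Γ.d i) (k i)}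
    (hφ : Set.MapsTo φ (Γ.X i) (Γ.X i)) (hK' : ∀ y ∈ Γ.X i, φ y = app K' (m i y)) :
    ∑ b ∈ Finset.range (p.Q ^ n), Γ.gain i φ (σ'.profile (r₀ + b)) ≤
      (p.Q : ℝ) ^ n * (5 / (2 * p.Q)) + (p.Q : ℝ) ^ n * (p.Q : ℝ) ^ 3 * p.Q / 2 *
        (‖σ.mat i - (1 - 1 / (p.Q : ℝ)) • K'‖ ^ 2 -
          ‖σ'.mat i - (1 - 1 / (p.Q : ℝ)) • K'‖ ^ 2) := by
  have hQ : (0 : ℝ) < p.Q := by exact_mod_cast p.Q_pos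
  have hgain := PhiEq.sum_gain_le hO p.Q_pos (pow_pos hQ 3) (hp.zero_mem i) (hp.sum_sq_le i)
    (fun j => (hsettled j).isTrajectory.mem) (hsettled i).isTrajectory hφ hK'
  rw [← hround.mat_eq hsettled,
    ← sum_range_digits n p.Q fun ℓ => Γ.gain i φ (pick τ.traj ℓ)] at hgain
  rw [Finset.sum_congr rfl fun b hb => by rw [hround.profile b (Finset.mem_range.1 hb)]]
  refine hgain.trans ?_
  gcongr _ + _ * (?_ - _)
  exact (hsettled i).norm_le K' fun y hy => hK' y hy ▸ hφ hy

theorem InRound.norm_sq_le (hO : O.Correct Γ m) (hp : p.Dominates m)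
    (hround : InRound O r₀ τ (p.Q ^ n) σ') (hsettled : ∀ i, Settled m i σ τ p.Q) :
    ‖σ'.mat i‖ ^ 2 ≤ ‖σ.mat i‖ ^ 2 + (2 * p.Q + 1) := by
  rw [hround.mat_eq hsettled]
  refine (norm_round_sq_le hO p.Q_pos (one_le_pow₀ p.one_le_Q) (hp.sum_sq_le i)
    (fun y hy => hp.norm_le hy) (fun j => (hsettled j).isTrajectory.mem)
    (hsettled i).isTrajectory).trans ?_
  have hsearch := (hsettled i).norm_le 0 fun y _ => by simpa [app_zero] using hp.zero_mem i
  simp only [smul_zero, sub_zero] at hsearch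
  linarith

/-- The state of the algorithm after `t` rounds. -/
structure Progress (m : (i : Fin n) → Vec (Γ.d i) → Fin (k i) → ℝ) (t : ℕ) (σ : Store p) :
    Prop where
  start : ∀ i, σ.traj i 0 = 0
  weight : ∀ r : Fin p.points, r < t * p.Q ^ n → σ (.weight r) () = 1 / (p.Q : ℝ) ^ (n + 7)
  profile_mem : ∀ r < t * p.Q ^ n, σ.profile r ∈ Γ.profiles
  norm_sq_le : ∀ i, ‖σ.mat i‖ ^ 2 ≤ t * (2 * p.Q + 1)
  sum_gain_le : ∀ i φ (K' : Mat (Γ.d i) (k i)), Set.MapsTo φ (Γ.X i) (Γ.X i) →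
    (∀ y ∈ Γ.X i, φ y = app K' (m i y)) →
    ∑ r ∈ Finset.range (t * p.Q ^ n), Γ.gain i φ (σ.profile r) ≤
      t * ((p.Q : ℝ) ^ n * (5 / (2 * p.Q))) + (p.Q : ℝ) ^ n * (p.Q : ℝ) ^ 3 * p.Q / 2 *
        (‖(1 - 1 / (p.Q : ℝ)) • K'‖ ^ 2 - ‖σ.mat i - (1 - 1 / (p.Q : ℝ)) • K'‖ ^ 2)

namespace Progress

theorem zero (htraj : ∀ i, σ.traj i 0 = 0) (hmat : ∀ i, σ.mat i = 0) : Progress m 0 σ where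
  start := htraj
  weight r hr := by simp at hr
  profile_mem r hr := by simp at hr
  norm_sq_le i := by simp [hmat]
  sum_gain_le i φ K' _ _ := by simp [hmat]

theorem norm_sq_le_three_mul (h : Progress m t σ) (ht : t ≤ p.Q ^ 7) (i : Fin n) :
    ‖σ.mat i‖ ^ 2 ≤ 3 * (p.Q : ℝ) ^ 8 :=
  calc ‖σ.mat i‖ ^ 2 ≤ t * (2 * p.Q + 1) := h.norm_sq_le i
    _ ≤ (p.Q : ℝ) ^ 7 * (2 * p.Q + p.Q) := by
        gcongr
        exacts [by exact_mod_cast ht, p.one_le_Q]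
    _ = 3 * (p.Q : ℝ) ^ 8 := by ring

theorem succ (h : Progress m t σ) (hO : O.Correct Γ m) (hp : p.Dominates m)
    (hsettled : ∀ i, Settled m i σ τ p.Q) (hframe : ∀ v : p.Var, v.owner = none → τ v = σ v)
    (hround : InRound O (t * p.Q ^ n) τ (p.Q ^ n) σ') : Progress m (t + 1) σ' := by
  refine ⟨fun i => ?_, fun r hr => ?_, fun r hr => ?_, fun i => ?_, fun i φ K' hφ hK' => ?_⟩
  · rw [← (hsettled i).start, Store.traj_congr fun _ => hround.frame _ rfl nofun]
  · rcases lt_or_ge (r : ℕ) (t * p.Q ^ n) with hlt | hge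
    · rw [hround.frame _ rfl (by rintro _ ⟨⟩; exact hlt), hframe _ rfl, h.weight r hlt]
    · exact hround.weight r hge (by rwa [Nat.succ_mul] at hr)
  · rcases lt_or_ge r (t * p.Q ^ n) with hlt | hge
    · exact hround.profile_eq hframe hlt ▸ h.profile_mem r hlt
    · obtain ⟨b, rfl⟩ := Nat.exists_eq_add_of_le hge
      exact hround.profile_mem hsettled (by rw [Nat.succ_mul] at hr; omega)
  · have hnorm := hround.norm_sq_le hO hp hsettled (i := i)
    push_cast
    linarith [h.norm_sq_le i]
  · have hnew := hround.sum_gain_le hO hp hsettled hφ hK'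
    rw [Nat.succ_mul, Finset.sum_range_add, Finset.sum_congr rfl fun r hr => by
      rw [hround.profile_eq hframe (Finset.mem_range.1 hr)]]
    push_cast
    linarith [h.sum_gain_le i φ K' hφ hK']

end Progress

end Round

namespace Prog

/-- All rounds. -/
def rounds (n : ℕ) : Prog n :=
  .seq (.nset (.const (2 * n + 2)) (.const 0)) (forN (2 * n + 1) (.pow (.size n) 7) (round n))

end Prog

theorem exists_runs_rounds (n : ℕ) : ∃ f : ℕ[X],
    ∀ {Γ : ConcaveGame n} {k : Fin n → ℕ} {m : (i : Fin n) → Vec (Γ.d i) → Fin (k i) → ℝ}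
      {O : Oracles Γ.d k} {p : Params Γ.d k} {s : Mem} {σ : Store p},
      O.Correct Γ m → p.Dominates m → σ.IsStored s → Progress m 0 σ →
      Runs O p.Q (Prog.rounds n) s f fun s' =>
        ∃ τ : Store p, τ.IsStored s' ∧ Progress m (p.Q ^ 7) τ := by
  obtain ⟨f, hf⟩ := exists_runs_round n
  refine ⟨_, fun {Γ k m O p s σ} hO hp hs h0 =>
    Runs.seq (Runs.nset (post := fun s' => s'.nat (2 * n + 2) = 0 ∧ σ.IsStored s')
      ⟨by simp, hs.setNat (by simp)⟩) fun s₁ ⟨hnat, hs₁⟩ =>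
    (Runs.forN (f := f) (g := X ^ 7) (B := p.Q ^ 7)
      (fun t s' => s'.nat (2 * n + 2) = t * p.Q ^ n ∧
        ∃ τ : Store p, τ.IsStored s' ∧ Progress m t τ) ?_ (by simp) ?_ ?_).mono
          fun _ h => h.2⟩
  · exact ⟨by simp [hnat], σ, hs₁.setNat (by omega), h0⟩
  · rintro t s' ⟨-, τ, hτ, -⟩
    simp [hτ.eval_size]
  · rintro t ht s' ⟨hnat, τ, hτ, hprogress⟩ hv
    have hle : t * p.Q ^ n + p.Q ^ n ≤ p.points := by
      rw [Params.points, pow_add, mul_comm (p.Q ^ n), ← Nat.succ_mul]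
      exact Nat.mul_le_mul_right _ ht
    refine (hf hO hp hτ hprogress.start (hprogress.norm_sq_le_three_mul ht.le) hnat hle).mono
      fun s'' ⟨hnat', τ₁, τ', hsettled, hframe, hround, hτ'⟩ =>
        ⟨(hτ'.agree _ (by omega)).trans hv,
          by rw [Mem.setNat_nat, if_neg (by omega), hnat', Nat.succ_mul], τ',
          hτ'.stored.setNat (by omega), hprogress.succ hO hp hsettled hframe hround⟩

/-! ### Choice of the size parameter and output -/

/-- The size parameters with which the algorithm may be run, for a game of total dimension
less than `b`. -/
def sizes (b : ℕ) (ε R D : ℝ) : Set ℕ :=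
  {N | b ≤ N ∧ D < N ∧ R < N ∧ 3 < N * ε}

theorem exists_isLeast_sizes {b : ℕ} {ε R D : ℝ} (hb : 1 ≤ b) (hε : 0 < ε) (hR : 0 ≤ R)
    (hD : 0 ≤ D) : ∃ Q, IsLeast (sizes b ε R D) Q ∧ (Q : ℝ) ≤ 3 * (b + R + D + 1 / ε) := by
  have hε' : 0 < 1 / ε := by positivity
  have hb' : (1 : ℝ) ≤ b := by exact_mod_cast hb
  set N := b + ⌈R + D + 3 * (1 / ε)⌉₊
  have hceil := Nat.le_ceil (R + D + 3 * (1 / ε))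
  have hN : (N : ℝ) = b + ⌈R + D + 3 * (1 / ε)⌉₊ := Nat.cast_add _ _
  have hmem : N ∈ sizes b ε R D := by
    refine ⟨Nat.le_add_right _ _, by linarith, by linarith, ?_⟩
    rw [← div_lt_iff₀ hε, div_eq_mul_one_div]
    linarith
  refine ⟨sInf (sizes b ε R D), ⟨Nat.sInf_mem ⟨N, hmem⟩, fun _ => Nat.sInf_le⟩, ?_⟩
  have hle : ((sInf (sizes b ε R D) : ℕ) : ℝ) ≤ N := by exact_mod_cast Nat.sInf_le hmem
  linarith [Nat.ceil_lt_add_one (a := R + D + 3 * (1 / ε)) (by positivity)]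

namespace Prog

/-- Store the least possible size parameter. -/
def setup (n : ℕ) : Prog n :=
  .seq (.nset (.const (2 * n)) (.const 1 + .sum (fun i : Fin n => .var i) +
      .sum fun i : Fin n => .var (n + i)))
    (.loop (.not (.and (.and (.rlt (.mem (.const 2)) (.ofNat (.size n)))
        (.rlt (.mem (.const 1)) (.ofNat (.size n))))
        (.rlt (.ofNat (.const 3)) (.ofNat (.size n) * .mem (.const 0)))))
      (.nset (.const (2 * n)) (.size n + .const 1)))

/-- The algorithm: choose the size parameter, play, and record the number of points. -/
def solve (n : ℕ) : Prog n :=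
  .seq (setup n) (.seq (rounds n) (.nset (.const 0) (.pow (.size n) (n + 7))))

end Prog

theorem exists_runs_setup (n : ℕ) : ∃ f : ℕ[X],
    ∀ {d k : Fin n → ℕ} {O : Oracles d k} {s : Mem} {Q : ℕ},
      IsLeast (sizes (1 + ∑ i : Fin n, s.nat i + ∑ i : Fin n, s.nat (n + i)) (s.real 0)
        (s.real 1) (s.real 2)) Q →
      Runs O Q (Prog.setup n) s f fun s' => s' = s.setNat (2 * n) Q := by
  refine ⟨_, fun {d k O s Q} hQ =>
    Runs.seq (Runs.nset (post := fun s' => s' = s.setNat (2 * n)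
      (1 + ∑ i : Fin n, s.nat i + ∑ i : Fin n, s.nat (n + i))) (by simp)) fun s₁ hs₁ =>
    (Runs.loop (g := X) (f := ((NExp.const (2 * n)).cost + (NExp.size n + .const 1).cost + 1 : ℕ))
      (fun s' => ∃ N, 1 + ∑ i : Fin n, s.nat i + ∑ i : Fin n, s.nat (n + i) ≤ N ∧ N ≤ Q ∧
        s' = s.setNat (2 * n) N) (fun s' => Q - s'.nat (2 * n)) ?_
      ⟨_, le_rfl, hQ.1.1, hs₁⟩ (by simp)).mono ?_⟩
  · rintro _ ⟨N, hN, hNQ, rfl⟩ hlarge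
    have hne : N ≠ Q := by
      rintro rfl
      exact hlarge (by simpa [BExp.holds, NExp.size, and_assoc] using hQ.1.2)
    refine Runs.nset ?_
    exact ⟨⟨N + 1, by omega, by omega, by simp [NExp.size, Mem.setNat]⟩, by
      simp [NExp.size]; omega⟩
  · rintro _ ⟨⟨N, hN, hNQ, rfl⟩, hlarge⟩
    rw [hNQ.antisymm (hQ.2 ⟨hN, ?_⟩)]
    simpa [BExp.holds, NExp.size, and_assoc] using hlarge

theorem FeatureBound.mono {d k : ℕ} {S : Set (Vec d)} {m : Vec d → Fin k → ℝ} {D D' : ℝ}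
    (h : FeatureBound S m D) (hD : 0 ≤ D) (hD' : D ≤ D') : FeatureBound S m D' :=
  ⟨fun x hx j => (h.1 x hx j).trans hD', fun φ hφ =>
    let ⟨K, hK, hsum⟩ := h.2 φ hφ
    ⟨K, hK, hsum.trans (pow_le_pow_left₀ hD hD' 2)⟩⟩

section Output

variable {n : ℕ} {Γ : ConcaveGame n} {k : Fin n → ℕ} {p : Params Γ.d k}
  {m : (i : Fin n) → Vec (Γ.d i) → Fin (k i) → ℝ} {σ : Store p}

theorem Params.inMemory_initMem {d k : Fin n → ℕ} (p : Params d k) (ε R D : ℝ) :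
    p.InMemory ((initMem d k ε R D).setNat (2 * n) p.Q) where
  nat_d i := by simp [initMem, show (i : ℕ) ≠ 2 * n by omega]
  nat_k i := by simp [initMem, show n + (i : ℕ) ≠ 2 * n by omega]
  nat_Q := by simp

theorem Params.initMem_real_cell {d k : Fin n → ℕ} (p : Params d k) (ε R D : ℝ) (a : ℕ)
    (i : Fin n) (row o : ℕ) : (initMem d k ε R D).real (p.cell a i row o) = 0 := by
  have h : 3 ≤ p.cell a i row o := by simp only [Params.cell]; omega
  simp only [initMem]
  rw [if_neg (by omega), if_neg (by omega), if_neg (by omega)]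

theorem Progress.ofMem_initMem (ε R D : ℝ) :
    Progress m 0 (Store.ofMem p ((initMem Γ.d k ε R D).setNat (2 * n) p.Q)) := by
  refine .zero (fun i => ?_) fun i => ?_ <;> ext o <;>
  exact p.initMem_real_cell ε R D _ _ _ _

/-- The uniform distribution on a list of `N` points. -/
noncomputable def FinDist.uniform {α : Type*} {N : ℕ} (hN : 0 < N) (x : Fin N → α) :
    FinDist α where
  size := N
  weight _ := 1 / N
  point := x
  weight_nonneg _ := by positivity
  weight_sum := by
    have : (N : ℝ) ≠ 0 := by positivity
    simp [this]

theorem Params.points_pos {d k : Fin n → ℕ} (p : Params d k) : 0 < p.points :=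
  pow_pos p.Q_pos _

/-- The distribution output by the algorithm in the state `σ`. -/
noncomputable def Store.output {d k : Fin n → ℕ} {p : Params d k} (σ : Store p) :
    FinDist (Profile d) :=
  .uniform p.points_pos σ.point

theorem Params.points_eq {d k : Fin n → ℕ} (p : Params d k) : p.points = p.Q ^ 7 * p.Q ^ n := by
  rw [Params.points, pow_add, mul_comm]

namespace Progress

theorem outputs (h : Progress m (p.Q ^ 7) σ) {s : Mem} (hs : σ.IsStored s) :
    Outputs (s.setNat 0 p.points) σ.output where
  left := by simp [Store.output, FinDist.uniform]
  right r := by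
    refine ⟨?_, hs.readProfile_point r⟩
    refine (hs.real_addr (.weight r) ()).trans ((h.weight r (p.points_eq ▸ r.2)).trans ?_)
    simp [Store.output, FinDist.uniform, Params.points]

theorem sum_gain_output_le (h : Progress m (p.Q ^ 7) σ) (hp : p.Dominates m) {i : Fin n}
    {φ : Vec (Γ.d i) → Vec (Γ.d i)} (hφ : φ ∈ phiSet (Γ.X i) (m i)) :
    ∑ r, Γ.gain i φ (σ.point r) ≤ 3 * (p.Q : ℝ) ^ (n + 6) := by
  obtain ⟨K, hK, hsum⟩ := (hp.featureBound i).2 φ hφ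
  have hQ := p.one_le_Q
  set K' : Mat (Γ.d i) (k i) := WithLp.toLp 2 fun q => K q.1 q.2
  have hK' : ∀ y ∈ Γ.X i, φ y = app K' (m i y) := fun y hy => by
    ext c
    exact hK y hy c
  have hnorm : ‖(1 - 1 / (p.Q : ℝ)) • K'‖ ^ 2 ≤ (p.Q : ℝ) ^ 2 := by
    have hnormK : ‖K'‖ ^ 2 ≤ (p.Q : ℝ) ^ 2 := by
      simpa [EuclideanSpace.norm_sq_eq, Fintype.sum_prod_type, K'] using hsum
    have hshrink : |1 - 1 / (p.Q : ℝ)| ≤ 1 := by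
      have : 1 / (p.Q : ℝ) ≤ 1 := div_le_one_of_le₀ hQ (by positivity)
      rw [abs_le]
      constructor <;> linarith [show 0 ≤ 1 / (p.Q : ℝ) by positivity]
    refine le_trans ?_ hnormK
    rw [norm_smul, Real.norm_eq_abs]
    gcongr
    exact mul_le_of_le_one_left (norm_nonneg _) hshrink
  calc ∑ r, Γ.gain i φ (σ.point r)
      = ∑ r ∈ Finset.range (p.Q ^ 7 * p.Q ^ n), Γ.gain i φ (σ.profile r) := by
        rw [← p.points_eq, ← Fin.sum_univ_eq_sum_range fun r => Γ.gain i φ (σ.profile r)]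
        simp [Store.profile]
    _ ≤ (p.Q ^ 7 : ℕ) * ((p.Q : ℝ) ^ n * (5 / (2 * p.Q))) +
          (p.Q : ℝ) ^ n * (p.Q : ℝ) ^ 3 * p.Q / 2 * ((p.Q : ℝ) ^ 2 - 0) := by
        refine (h.sum_gain_le i φ K' hφ.1 hK').trans ?_
        gcongr
        positivity
    _ = 3 * (p.Q : ℝ) ^ (n + 6) := by
        field_simp
        push_cast
        ring

theorem isApproxEquilibrium (h : Progress m (p.Q ^ 7) σ) (hp : p.Dominates m) {ε : ℝ}
    (hε : 3 < p.Q * ε) :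
    IsApproxEquilibrium Γ (fun i => phiSet (Γ.X i) (m i)) ε σ.output := by
  refine ⟨fun r => ?_, fun i φ hφ => ?_⟩
  · have hmem := h.profile_mem r (p.points_eq ▸ r.2)
    rwa [Store.profile, dif_pos (show (r : ℕ) < p.points from r.2)] at hmem
  · have hQ : (0 : ℝ) < p.Q := by exact_mod_cast p.Q_pos
    calc σ.output.expect (fun x => Γ.u i (Function.update x i (φ (x i))) - Γ.u i x)
        = (∑ r, Γ.gain i φ (σ.point r)) / (p.Q : ℝ) ^ (n + 7) := by
          rw [Finset.sum_div]
          refine Finset.sum_congr rfl fun r _ => ?_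
          simp [Store.output, FinDist.uniform, Params.points, ConcaveGame.gain, div_eq_inv_mul]
      _ ≤ 3 * (p.Q : ℝ) ^ (n + 6) / (p.Q : ℝ) ^ (n + 7) := by
          gcongr
          exact h.sum_gain_output_le hp hφ
      _ = 3 / p.Q := by
          rw [pow_succ _ (n + 6)]
          field_simp
      _ ≤ ε := (div_le_iff₀' hQ).2 hε.le

end Progress

end Output

theorem Params.Dominates.of_sizes {n : ℕ} {Γ : ConcaveGame n} {k : Fin n → ℕ} {p : Params Γ.d k}
    {m : (i : Fin n) → Vec (Γ.d i) → Fin (k i) → ℝ} {b : ℕ} {ε R D : ℝ}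
    (hQ : p.Q ∈ sizes b ε R D) (hD : 0 ≤ D)
    (hball : ∀ i, Metric.closedBall 0 1 ⊆ Γ.X i ∧ Γ.X i ⊆ Metric.closedBall 0 R)
    (hfeat : ∀ i, FeatureBound (Γ.X i) (m i) D) : p.Dominates m where
  closedBall_subset i := (hball i).1
  subset_closedBall i := (hball i).2.trans (Metric.closedBall_subset_closedBall hQ.2.2.1.le)
  featureBound i := (hfeat i).mono hD hQ.2.1.le

theorem exists_runs_solve (n : ℕ) : ∃ f : ℕ[X],
    ∀ {Γ : ConcaveGame n} {k : Fin n → ℕ} {m : (i : Fin n) → Vec (Γ.d i) → Fin (k i) → ℝ}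
      {O : Oracles Γ.d k} {p : Params Γ.d k} {ε R D : ℝ},
      O.Correct Γ m → p.Dominates m →
      IsLeast (sizes (1 + ∑ i, Γ.d i + ∑ i, k i) ε R D) p.Q →
      Runs O p.Q (Prog.solve n) (initMem Γ.d k ε R D) f fun s' =>
        ∃ μ, Outputs s' μ ∧ IsApproxEquilibrium Γ (fun i => phiSet (Γ.X i) (m i)) ε μ := by
  obtain ⟨f, hf⟩ := exists_runs_setup n
  obtain ⟨g, hg⟩ := exists_runs_rounds n
  refine ⟨_, fun {Γ k m O p ε R D} hO hp hQ =>
    Runs.seq (hf (Q := p.Q) ?_) fun s₁ hs₁ =>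
    Runs.seq (hg (s := s₁) hO hp (Store.isStored_ofMem (hs₁ ▸ p.inMemory_initMem ε R D))
      (hs₁ ▸ Progress.ofMem_initMem ε R D)) fun s₂ ⟨τ, hs₂, hprogress⟩ =>
    Runs.nset ⟨τ.output, ?_, hprogress.isApproxEquilibrium hp hQ.1.2.2.2⟩⟩
  · simpa [initMem] using hQ
  · simpa [hs₂.eval_size, Params.points] using hprogress.outputs hs₂

theorem exists_forall_eval_le_mul_pow (f : ℕ[X]) :
    ∃ C e : ℕ, ∀ (q : ℕ) (z : ℝ), 1 ≤ z → (q : ℝ) ≤ 3 * z → ((f.eval q : ℕ) : ℝ) ≤ C * z ^ e := by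
  refine ⟨f.eval 3, f.natDegree, fun q z hz hqz => ?_⟩
  simp only [Polynomial.eval_eq_sum_range, Nat.cast_sum, Nat.cast_mul, Nat.cast_pow, Finset.sum_mul]
  refine Finset.sum_le_sum fun j hj => ?_
  rw [mul_assoc]
  gcongr
  calc (q : ℝ) ^ j ≤ (3 * z) ^ j := by gcongr
    _ = 3 ^ j * z ^ j := mul_pow _ _ _
    _ ≤ 3 ^ j * z ^ f.natDegree := by
        gcongr
        exact Nat.lt_succ_iff.1 (Finset.mem_range.1 hj)
    _ = ((3 : ℕ) : ℝ) ^ j * z ^ f.natDegree := by norm_num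

end PhiEq

theorem mainTheorem4 (n : ℕ) :
    ∃ (P : PhiEq.Prog n) (C e : ℕ),
      ∀ (Γ : PhiEq.ConcaveGame n) (k : Fin n → ℕ)
        (m : (i : Fin n) → PhiEq.Vec (Γ.d i) → Fin (k i) → ℝ)
        (O : PhiEq.Oracles Γ.d k) (R D ε : ℝ),
        O.Correct Γ m →
        0 < R →
        0 ≤ D →
        0 < ε →
        (∀ i, Metric.closedBall 0 1 ⊆ Γ.X i ∧ Γ.X i ⊆ Metric.closedBall 0 R) →
        (∀ i, PhiEq.FeatureBound (Γ.X i) (m i) D) →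
        ∃ (t : ℕ) (s : PhiEq.Mem) (μ : PhiEq.FinDist (PhiEq.Profile Γ.d)),
          PhiEq.Exec O P (PhiEq.initMem Γ.d k ε R D) t s ∧
          (t : ℝ) ≤ C * (1 + ∑ i, (Γ.d i : ℝ) + ∑ i, (k i : ℝ) + R + D + 1 / ε) ^ e ∧
          PhiEq.Outputs s μ ∧
          PhiEq.IsApproxEquilibrium Γ (fun i => PhiEq.phiSet (Γ.X i) (m i)) ε μ := by
  obtain ⟨f, hf⟩ := PhiEq.exists_runs_solve n
  obtain ⟨C, e, hCe⟩ := PhiEq.exists_forall_eval_le_mul_pow f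
  refine ⟨PhiEq.Prog.solve n, C, e, fun Γ k m O R D ε hO hR hD hε hball hfeat => ?_⟩
  obtain ⟨Q, hleast, hQ⟩ := PhiEq.exists_isLeast_sizes (b := 1 + ∑ i, Γ.d i + ∑ i, k i)
    (by omega) hε hR.le hD
  push_cast at hQ
  have hZ : 1 ≤ 1 + ∑ i, (Γ.d i : ℝ) + ∑ i, (k i : ℝ) + R + D + 1 / ε := by
    have : 0 ≤ ∑ i, (Γ.d i : ℝ) + ∑ i, (k i : ℝ) + R + D + 1 / ε := by positivity
    linarith
  let p : PhiEq.Params Γ.d k :=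
    ⟨Q, by have := hleast.1.1; omega, by have := hleast.1.1; omega⟩
  obtain ⟨t, s, hexec, ht, μ, hμ, heq⟩ := hf (p := p) hO (.of_sizes hleast.1 hD hball hfeat) hleast
  exact ⟨t, s, μ, hexec, (Nat.cast_le.2 ht).trans (hCe Q _ hZ hQ), hμ, heq⟩
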